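/- All sequences are sequences of non-negative integers. For a sequence $\mathbf{c} = (c_1, \dots, c_n)$ with $1 \le c_1 \le \dots \le c_n$ (an IP sequence) and $r \in [n] = \{1, \dots, n\}$, let $S_{\mathbf{c}}^{(r)}$ be the set of sequences $(a_1, \dots, a_n)$ with $0 \le a_i \le c_i$ for each $i \in [n]$ and with exactly $r$ nonzero entries, and let $S_{\mathbf{c}}^{(r)}(1)$ be the set of those with $a_1 = 1$. A sequence $(a_1, \dots, a_m)$ meets a sequence $(b_1, \dots, b_n)$ if $a_i = b_i \neq 0$ for some $i \le \min\{m,n\}$. Theorem. Let $k \ge 2$, let $\mathbf{c}_i = (c_{i,1}, \dots, c_{i,n_i})$, $i \in [k]$, be IP sequences, and let $r_i \in [n_i]$ for each $i \in [k]$. Suppose that either $c_{i,1} \ge 3$ for each $i \in [k]$, or $\mathbf{c}_1 = \dots = \mathbf{c}_k$ and $r_1 = \dots = r_k = n_1$. Let $A_i \subseteq S_{\mathbf{c}_i}^{(r_i)}$, $i \in [k]$, be such that for all $p, q \in [k]$ with $p \neq q$, each sequence in $A_p$ meets each sequence in $A_q$. Then \[ \prod_{i=1}^k |A_i| \le \prod_{i=1}^k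 \Bigl( \sum_{I} \prod_{j \in I} c_{i,j} \Bigr), \] where, in the $i$-th factor, $I$ runs over the $(r_i - 1)$-element subsets of $\{2, \dots, n_i\}$, and equality holds if $A_i = S_{\mathbf{c}_i}^{(r_i)}(1)$ for each $i \in [k]$ (so the right-hand side is $\prod_{i=1}^k |S_{\mathbf{c}_i}^{(r_i)}(1)|$). Moreover, unless $c_{1,1} = 2$, equality holds if and only if there are a position $p \in [\min\{n_1, \dots, n_k\}]$ such that, for each $i \in [k]$, $c_{i,p} = c_{i,1}$ or $r_i = 1$, and an integer $q$ with $1 \le q \le \min\{c_{1,p}, \dots, c_{k,p}\}$, such that \[ A_i = \{ (a_1, \dots, a_{n_i}) \in S_{\mathbf{c}_i}^{(r_i)} : a_p = q \} \quad \text{for each } i \in [k]. \] (If $r_i \ge 2$ for each $i$, the condition on $p$ says that $c_{i,p} = c_{i,1}$ for each $i \in [k]$.) -/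

import Mathlib

namespace IntSeq

/-- `c` is an increasing positive sequence (IP sequence): `1 ≤ c_1 ≤ ... ≤ c_n`. -/
def IsIP {n : ℕ} (c : Fin n → ℕ) : Prop :=
  Monotone c ∧ ∀ i, 1 ≤ c i

/-- The set `S_c^{(r)}` of the sequences `(a_1, ..., a_n)` of non-negative integers with exactly `r`
nonzero entries and with `0 ≤ a_i ≤ c_i` for every `i`. Positions are numbered from `0`. -/
def S {n : ℕ} (c : Fin n → ℕ) (r : ℕ) : Finset (Fin n → ℕ) :=
  (Fintype.piFinset fun i => Finset.Icc 0 (c i)).filter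
    fun a => (Finset.univ.filter fun i => a i ≠ 0).card = r

/-- The sequences in `S_c^{(r)}` whose entry in position `p` is `q`. -/
def star {n : ℕ} (c : Fin n → ℕ) (r : ℕ) (p : Fin n) (q : ℕ) : Finset (Fin n → ℕ) :=
  (S c r).filter fun a => a p = q

/-- Two sequences, possibly of different lengths, meet: they agree on some nonzero entry. -/
def Meets {m n : ℕ} (a : Fin m → ℕ) (b : Fin n → ℕ) : Prop :=
  ∃ (i : ℕ) (hm : i < m) (hn : i < n), a ⟨i, hm⟩ = b ⟨i, hn⟩ ∧ a ⟨i, hm⟩ ≠ 0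

/-- Equality of two sequences given with their lengths. -/
def SameSeq {m n : ℕ} (a : Fin m → ℕ) (b : Fin n → ℕ) : Prop :=
  m = n ∧ ∀ (i : ℕ) (hm : i < m) (hn : i < n), a ⟨i, hm⟩ = b ⟨i, hn⟩

/-- The sum of `∏_{j ∈ I} c_j` over the `(r - 1)`-element sets `I` of positions other than the
first. It is used only for `1 ≤ r ≤ n`. -/
def bound {n : ℕ} [NeZero n] (c : Fin n → ℕ) (r : ℕ) : ℕ :=
  ∑ I ∈ ((Finset.univ : Finset (Fin n)).erase 0).powersetCard (r - 1), ∏ j ∈ I, c j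

end IntSeq

/-! Two families suffice: multiplying the bounds for the pairs `(i, i + d)` over all indices modulo
`k` gives the square of the desired bound, and equality in the product forces equality in every pair
(`prod_le_prod_of_mul_le_mul`).

For a pair with all bounds at least 3, both families are padded with zeros to a common length, and
entries are lowered to 1 by compressions that preserve sizes and the meeting property
(`compr_induction`). In a pair closed under lowering, any two members share an entry 1
(`exists_one_of_stable`), so the sets of positions of the 1s cross-intersect. Weighting a set by the
number of sequences whose 1s are exactly there leaves a problem on set families. Since a 1 can be
changed to 2 or 3, adding an element at least halves the weight; since the bounds increase, smaller
elements weigh more.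

The core is `starBound_of_crossInt`, by induction on the largest element `a` of the ground set.
Splitting both families according to whether `a` is contained turns the product into a sum of four
products. Three of these pairs cross-intersect for trivial reasons. The links of `a` do so in a
shifted pair of maximum product (`crossInt_link`): two disjoint links would allow trading a set of
one family for a new set in the other, in either direction, and both trades cannot fail to increase
the product.

Equality yields a common singleton, hence stars for the lowered families;
`exists_star_of_compr_lower` undoes the lowering. If all entries are nonzero and the first bound is
1, every sequence starts with 1; if it is 2, rotating all values cyclically gives the bound
(`card_mul_card_le_of_zero_eq_two`). -/

namespace IntSeq

/-! ### Compressions of cross-related families. -/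

section Compression

variable {β : Type*} [DecidableEq β]

/-- The compression of the family `s` along the map `f`. -/
def compr (f : β → β) (s : Finset β) : Finset β :=
  s.image fun a => if f a ∈ s then a else f a

theorem compr_injOn {f : β → β} (hf : ∀ a b, f a ≠ a → f b ≠ b → f a = f b → a = b)
    (s : Finset β) : Set.InjOn (fun a => if f a ∈ s then a else f a) (s : Set β) := by
  intro a ha b hb hab
  have ha' : a ∈ s := ha
  have hb' : b ∈ s := hb
  simp only at hab
  split_ifs at hab with h1 h2 h2
  · exact hab
  · exact absurd (hab ▸ ha') h2
  · exact absurd (hab ▸ hb') h1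
  · exact hf a b (fun h => h1 (by rwa [h])) (fun h => h2 (by rwa [h])) hab

theorem card_compr {f : β → β} (hf : ∀ a b, f a ≠ a → f b ≠ b → f a = f b → a = b)
    (s : Finset β) : (compr f s).card = s.card :=
  Finset.card_image_of_injOn (compr_injOn hf s)

theorem sum_compr {M : Type*} [AddCommMonoid M] {f : β → β}
    (hf : ∀ a b, f a ≠ a → f b ≠ b → f a = f b → a = b) (s : Finset β) (u : β → M) :
    ∑ a ∈ compr f s, u a = ∑ a ∈ s, u (if f a ∈ s then a else f a) :=
  Finset.sum_image (compr_injOn hf s)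

theorem mem_compr {f : β → β} {s : Finset β} {x : β} :
    x ∈ compr f s ↔ (x ∈ s ∧ f x ∈ s) ∨ ∃ a ∈ s, f a ∉ s ∧ f a = x := by
  simp only [compr, Finset.mem_image]
  constructor
  · rintro ⟨a, ha, rfl⟩
    split_ifs with h
    · exact Or.inl ⟨ha, h⟩
    · exact Or.inr ⟨a, ha, h, rfl⟩
  · rintro (⟨h1, h2⟩ | ⟨a, ha, h, rfl⟩)
    · exact ⟨x, h1, if_pos h2⟩
    · exact ⟨a, ha, if_neg h⟩

/-- The delicate case pairs a moved member with one that stayed. The latter stayed because its image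
is also in its family, so the original of the moved member is related to both, which is what `h2`
needs. -/
theorem cross_compr {f : β → β} {R : β → β → Prop} (hsymm : ∀ a b, R a b → R b a)
    (h1 : ∀ a b, R a b → R (f a) (f b))
    (h2 : ∀ a b, f a ≠ a → R a b → R a (f b) → R (f a) b)
    {s t : Finset β} (hst : ∀ a ∈ s, ∀ b ∈ t, R a b) :
    ∀ a ∈ compr f s, ∀ b ∈ compr f t, R a b := by
  intro a ha b hb
  rw [mem_compr] at ha hb
  rcases ha with ⟨ha, hfa⟩ | ⟨a, ha, hfa, rfl⟩ <;> rcases hb with ⟨hb, hfb⟩ | ⟨b, hb, hfb, rfl⟩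
  · exact hst _ ha _ hb
  · exact hsymm _ _ (h2 b a (fun h => hfb (h.symm ▸ hb)) (hsymm _ _ (hst _ ha _ hb))
      (hsymm _ _ (hst _ hfa _ hb)))
  · exact h2 a b (fun h => hfa (h.symm ▸ ha)) (hst _ ha _ hb) (hst _ ha _ hfb)
  · exact h1 _ _ (hst _ ha _ hb)

/-- To prove a property of all cross-related pairs of families, it suffices to prove it for pairs
that are closed under all the maps `f x` and to transfer it back along compressions. -/
theorem compr_induction {κ : Type*} {f : κ → β → β} {R : β → β → Prop} (φ : β → ℕ)
    (hf : ∀ x a b, f x a ≠ a → f x b ≠ b → f x a = f x b → a = b)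
    (hφ : ∀ x a, f x a ≠ a → φ (f x a) < φ a)
    (hsymm : ∀ a b, R a b → R b a)
    (h1 : ∀ x a b, R a b → R (f x a) (f x b))
    (h2 : ∀ x a b, f x a ≠ a → R a b → R a (f x b) → R (f x a) b)
    {P : Finset β → Finset β → Prop}
    (hstable : ∀ s t, (∀ a ∈ s, ∀ b ∈ t, R a b) → (∀ x, ∀ a ∈ s, f x a ∈ s) →
      (∀ x, ∀ b ∈ t, f x b ∈ t) → P s t)
    (hback : ∀ x s t, (∀ a ∈ s, ∀ b ∈ t, R a b) → P (compr (f x) s) (compr (f x) t) → P s t)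
    (s t : Finset β) (hst : ∀ a ∈ s, ∀ b ∈ t, R a b) : P s t := by
  have hle : ∀ x (u : Finset β), ∑ a ∈ compr (f x) u, φ a ≤ ∑ a ∈ u, φ a := by
    intro x u
    rw [sum_compr (hf x)]
    refine Finset.sum_le_sum fun a ha => ?_
    split_ifs with h
    · exact le_rfl
    · exact (hφ x a fun h' => h (h'.symm ▸ ha)).le
  have hlt : ∀ x (u : Finset β), (∃ a ∈ u, f x a ∉ u) →
      ∑ a ∈ compr (f x) u, φ a < ∑ a ∈ u, φ a := by
    rintro x u ⟨a, ha, hfa⟩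
    rw [sum_compr (hf x)]
    refine Finset.sum_lt_sum (fun a ha => ?_) ⟨a, ha, ?_⟩
    · split_ifs with h
      · exact le_rfl
      · exact (hφ x a fun h' => h (h'.symm ▸ ha)).le
    · rw [if_neg hfa]
      exact hφ x a fun h' => hfa (h'.symm ▸ ha)
  -- The total of `φ` strictly drops under any compression that changes one of the families.
  induction hn : (∑ a ∈ s, φ a + ∑ b ∈ t, φ b) using Nat.strong_induction_on generalizing s t with
  | _ n ih =>
    by_cases hs : ∀ x, ∀ a ∈ s, f x a ∈ s
    · by_cases ht : ∀ x, ∀ b ∈ t, f x b ∈ t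
      · exact hstable s t hst hs ht
      · push Not at ht
        obtain ⟨x, hx⟩ := ht
        refine hback x s t hst (ih _ ?_ _ _ (cross_compr hsymm (h1 x) (h2 x) hst) rfl)
        have := hle x s
        have := hlt x t hx
        omega
    · push Not at hs
      obtain ⟨x, hx⟩ := hs
      refine hback x s t hst (ih _ ?_ _ _ (cross_compr hsymm (h1 x) (h2 x) hst) rfl)
      have := hlt x s hx
      have := hle x t
      omega

end Compression

/-! ### Weighted cross-intersecting set families. -/

section Weighted

variable {N : ℕ}

/-- Every member of `s` intersects every member of `t`. -/
def CrossInt (s t : Finset (Finset (Fin N))) : Prop :=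
  ∀ X ∈ s, ∀ Y ∈ t, ¬ Disjoint X Y

theorem CrossInt.symm {s t : Finset (Finset (Fin N))} (h : CrossInt s t) : CrossInt t s :=
  fun X hX Y hY hd => h Y hY X hX hd.symm

/-- A weight on the subsets of `V` that at least halves when an element is added and does not
decrease when an element is replaced by a smaller one. -/
structure IsWeight (V : Finset (Fin N)) (g : Finset (Fin N) → ℝ) : Prop where
  nonneg : ∀ X, 0 ≤ g X
  halve : ∀ X ⊆ V, ∀ y ∈ V, y ∉ X → 2 * g (insert y X) ≤ g X
  replace : ∀ Z ⊆ V, ∀ i ∈ V, ∀ j ∈ V, i < j → i ∉ Z → j ∉ Z → g (insert j Z) ≤ g (insert i Z)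

theorem IsWeight.mono {V W : Finset (Fin N)} {g : Finset (Fin N) → ℝ} (hg : IsWeight W g)
    (h : V ⊆ W) : IsWeight V g :=
  ⟨hg.nonneg, fun X hX y hy => hg.halve X (hX.trans h) y (h hy),
    fun Z hZ i hi j hj => hg.replace Z (hZ.trans h) i (h hi) j (h hj)⟩

theorem IsWeight.insert {V : Finset (Fin N)} {a : Fin N} {g : Finset (Fin N) → ℝ}
    (hg : IsWeight (insert a V) g) (ha : a ∉ V) : IsWeight V fun X => g (insert a X) := by
  refine ⟨fun X => hg.nonneg _, fun X hX y hy hyX => ?_, fun Z hZ i hi j hj hij hiZ hjZ => ?_⟩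
  · have hya : y ≠ a := fun h => ha (h ▸ hy)
    have := hg.halve (Insert.insert a X) (Finset.insert_subset_insert a hX) y
      (Finset.mem_insert_of_mem hy) (by simp [hya, hyX])
    rwa [Finset.insert_comm] at this
  · have hia : i ≠ a := fun h => ha (h ▸ hi)
    have hja : j ≠ a := fun h => ha (h ▸ hj)
    have := hg.replace (Insert.insert a Z) (Finset.insert_subset_insert a hZ) i
      (Finset.mem_insert_of_mem hi) j (Finset.mem_insert_of_mem hj) hij (by simp [hia, hiZ])
      (by simp [hja, hjZ])
    rwa [Finset.insert_comm, Finset.insert_comm i a] at this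

/-- Replace the element `j` by the smaller element `i` of `V`, if possible. -/
def shift (V : Finset (Fin N)) (x : Fin N × Fin N) (X : Finset (Fin N)) : Finset (Fin N) :=
  if x.1 < x.2 ∧ x.1 ∈ V ∧ x.1 ∉ X ∧ x.2 ∈ X then insert x.1 (X.erase x.2) else X

theorem shift_ne {V : Finset (Fin N)} {x : Fin N × Fin N} {X : Finset (Fin N)}
    (h : shift V x X ≠ X) : (x.1 < x.2 ∧ x.1 ∈ V ∧ x.1 ∉ X ∧ x.2 ∈ X) ∧
      shift V x X = insert x.1 (X.erase x.2) := by
  unfold shift at h ⊢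
  split_ifs at h ⊢ with h1
  · exact ⟨h1, rfl⟩
  · exact absurd rfl h

theorem shift_subset {V X : Finset (Fin N)} (x : Fin N × Fin N) (hX : X ⊆ V) :
    shift V x X ⊆ V := by
  unfold shift
  split_ifs with h
  · exact Finset.insert_subset h.2.1 ((Finset.erase_subset _ _).trans hX)
  · exact hX

theorem IsWeight.le_shift {V X : Finset (Fin N)} {g : Finset (Fin N) → ℝ} (hg : IsWeight V g)
    (x : Fin N × Fin N) (hX : X ⊆ V) : g X ≤ g (shift V x X) := by
  unfold shift
  split_ifs with h
  · obtain ⟨h1, h2, h3, h4⟩ := h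
    have := hg.replace (X.erase x.2) ((Finset.erase_subset _ _).trans hX) x.1 h2 x.2 (hX h4) h1
      (fun h => h3 (Finset.mem_of_mem_erase h)) (Finset.notMem_erase _ _)
    rwa [Finset.insert_erase h4] at this
  · exact le_rfl

theorem shift_inj {V : Finset (Fin N)} (x : Fin N × Fin N) (X Y : Finset (Fin N))
    (hX : shift V x X ≠ X) (hY : shift V x Y ≠ Y) (h : shift V x X = shift V x Y) : X = Y := by
  obtain ⟨⟨-, -, hX1, hX2⟩, hX⟩ := shift_ne hX
  obtain ⟨⟨-, -, hY1, hY2⟩, hY⟩ := shift_ne hY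
  rw [hX, hY] at h
  have h1 : x.1 ∉ X.erase x.2 := fun h => hX1 (Finset.mem_of_mem_erase h)
  have h2 : x.1 ∉ Y.erase x.2 := fun h => hY1 (Finset.mem_of_mem_erase h)
  have : X.erase x.2 = Y.erase x.2 := by
    rw [← Finset.erase_insert h1, h, Finset.erase_insert h2]
  rw [← Finset.insert_erase hX2, this, Finset.insert_erase hY2]

theorem sum_val_shift_lt {V : Finset (Fin N)} (x : Fin N × Fin N) (X : Finset (Fin N))
    (hX : shift V x X ≠ X) : ∑ i ∈ shift V x X, (i : ℕ) < ∑ i ∈ X, (i : ℕ) := by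
  obtain ⟨⟨h1, -, h3, h4⟩, hX⟩ := shift_ne hX
  rw [hX, Finset.sum_insert fun h => h3 (Finset.mem_of_mem_erase h),
    ← Finset.add_sum_erase X (fun i : Fin N => (i : ℕ)) h4]
  have : (x.1 : ℕ) < x.2 := h1
  omega

theorem not_disjoint_shift_shift {V : Finset (Fin N)} (x : Fin N × Fin N) (X Y : Finset (Fin N))
    (h : ¬ Disjoint X Y) : ¬ Disjoint (shift V x X) (shift V x Y) := by
  rw [Finset.not_disjoint_iff] at h ⊢
  obtain ⟨k, hkX, hkY⟩ := h
  unfold shift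
  by_cases hk : k = x.2
  · subst hk
    by_cases h0 : x.1 < x.2 ∧ x.1 ∈ V
    · exact ⟨x.1, by grind⟩
    · exact ⟨x.2, by grind⟩
  · exact ⟨k, by grind⟩

/-- The only danger is that `X` and `Y` share just the lost element `x.2`, with `x.1 ∉ Y`. Then `Y`
is shifted too, and an element common to `X` and the shifted `Y` is neither `x.1` nor `x.2`, so it
survives. -/
theorem not_disjoint_shift_left {V : Finset (Fin N)} (x : Fin N × Fin N) (X Y : Finset (Fin N))
    (hX : shift V x X ≠ X) (h : ¬ Disjoint X Y) (h' : ¬ Disjoint X (shift V x Y)) :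
    ¬ Disjoint (shift V x X) Y := by
  obtain ⟨⟨h1, h2, h3, h4⟩, hX⟩ := shift_ne hX
  rw [hX]
  rw [Finset.not_disjoint_iff] at h h' ⊢
  obtain ⟨k, hkX, hkY⟩ := h
  obtain ⟨l, hlX, hlY⟩ := h'
  unfold shift at hlY
  by_cases hi : x.1 ∈ Y
  · exact ⟨x.1, by simp, hi⟩
  · by_cases hk : k = x.2
    · refine ⟨l, ?_⟩
      grind
    · exact ⟨k, by grind⟩

/-- The subsets of `V` that contain `m`. -/
def setStar (V : Finset (Fin N)) (m : Fin N) : Finset (Finset (Fin N)) :=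
  V.powerset.filter fun X => m ∈ X

/-- The families of subsets of `V` that are closed under replacing an element by a smaller one. -/
def IsShifted (V : Finset (Fin N)) (s : Finset (Finset (Fin N))) : Prop :=
  ∀ X ∈ s, ∀ i ∈ V, ∀ j, i < j → i ∉ X → j ∈ X → insert i (X.erase j) ∈ s

/-- Links of weight zero are dropped without changing the sum, because `crossInt_link` controls only
links of positive weight. -/
theorem sum_eq_add_of_subset_powerset_insert {V : Finset (Fin N)} {a : Fin N} (ha : a ∉ V)
    {s : Finset (Finset (Fin N))} (hs : s ⊆ (insert a V).powerset) {g : Finset (Fin N) → ℝ}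
    (hg : ∀ X, 0 ≤ g X) :
    ∑ X ∈ s, g X = ∑ X ∈ V.powerset.filter (· ∈ s), g X +
      ∑ X ∈ V.powerset.filter (fun X => insert a X ∈ s ∧ 0 < g (insert a X)), g (insert a X) := by
  have h1 : ∑ X ∈ s, g X = ∑ X ∈ (insert a V).powerset, if X ∈ s then g X else 0 := by
    rw [← Finset.sum_filter, Finset.filter_mem_eq_inter, Finset.inter_eq_right.mpr hs]
  rw [h1, Finset.sum_powerset_insert ha, Finset.sum_filter, Finset.sum_filter]
  congr 1
  refine Finset.sum_congr rfl fun X _ => ?_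
  by_cases h : insert a X ∈ s
  · by_cases h0 : 0 < g (insert a X)
    · simp [h, h0]
    · simp [h, le_antisymm (not_lt.mp h0) (hg _)]
  · simp [h]

theorem sum_setStar_insert {V : Finset (Fin N)} {a m : Fin N} (ha : a ∉ V) (hm : m ∈ V)
    (g : Finset (Fin N) → ℝ) :
    ∑ X ∈ setStar (insert a V) m, g X =
      ∑ X ∈ setStar V m, g X + ∑ X ∈ setStar V m, g (insert a X) := by
  have hma : m ≠ a := fun h => ha (h ▸ hm)
  simp only [setStar, Finset.sum_filter]
  rw [Finset.sum_powerset_insert ha]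
  simp [hma]

/-- Otherwise shifting `a` to `i` puts `insert i X` in `s`, and this set is disjoint from `Z`. -/
theorem IsShifted.mem_or_mem {V : Finset (Fin N)} {a : Fin N} (ha : ∀ x ∈ V, x < a)
    {s t : Finset (Finset (Fin N))} (hst : CrossInt s t) (hs : IsShifted (insert a V) s)
    {X Z : Finset (Fin N)} (hXV : X ⊆ V) (hX : insert a X ∈ s) (hZ : Z ∈ t)
    (hXZ : Disjoint X Z) {i : Fin N} (hi : i ∈ V) : i ∈ X ∨ i ∈ Z := by
  by_contra! h
  have haX : a ∉ X := fun h => (ha a (hXV h)).false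
  have h1 := hs _ hX i (Finset.mem_insert_of_mem hi) a (ha i hi)
    (by simp [h.1, (ha i hi).ne]) (Finset.mem_insert_self _ _)
  rw [Finset.erase_insert haX] at h1
  refine hst _ h1 _ hZ ?_
  rw [Finset.disjoint_insert_left]
  exact ⟨h.2, hXZ⟩

/-- A member of `t` disjoint from `X` must contain `a` and, by `IsShifted.mem_or_mem`, every element
of `V` outside `X`. It is thus the complement of `X`, so there is only one. -/
theorem IsShifted.eq_insert_of_disjoint {V : Finset (Fin N)} {a : Fin N} (ha : ∀ x ∈ V, x < a)
    {s t : Finset (Finset (Fin N))} (hst : CrossInt s t) (hs : IsShifted (insert a V) s)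
    (ht : t ⊆ (insert a V).powerset)
    {X Y Z : Finset (Fin N)} (hXV : X ⊆ V) (hYV : Y ⊆ V) (hX : insert a X ∈ s)
    (hY : insert a Y ∈ t) (hXY : Disjoint X Y) (hZ : Z ∈ t) (hXZ : Disjoint X Z) :
    Z = insert a Y := by
  have haX : a ∉ X := fun h => (ha a (hXV h)).false
  have haZ : a ∈ Z := by
    by_contra haZ
    exact hst _ hX _ hZ (Finset.disjoint_insert_left.mpr ⟨haZ, hXZ⟩)
  have hZV := Finset.mem_powerset.mp (ht hZ)
  have hXY' : Disjoint X (insert a Y) := Finset.disjoint_insert_right.mpr ⟨haX, hXY⟩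
  ext i
  by_cases hia : i = a
  · simp [hia, haZ]
  by_cases hiV : i ∈ V
  · have h1 := hs.mem_or_mem ha hst hXV hX hZ hXZ hiV
    have h2 := hs.mem_or_mem ha hst hXV hX hY hXY' hiV
    constructor
    · intro h
      exact h2.resolve_left fun h' => Finset.disjoint_left.mp hXZ h' h
    · intro h
      exact h1.resolve_left fun h' => Finset.disjoint_left.mp hXY' h' h
  · constructor
    · intro h
      exact absurd (Finset.mem_of_mem_insert_of_ne (hZV h) hia) hiV
    · intro h
      exact absurd (hYV (Finset.mem_of_mem_insert_of_ne h hia)) hiV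

/-- Shifting an element of `insert a X` to the minimum `m` gives further members of `s` of no
smaller weight. A nonempty `X` gives two of them, by shifting `a` or some `x ∈ X`. If `X` is empty
there is only one, but then every member of `t` is disjoint from `X`, so `t` has the single member
`insert a Y`. -/
theorem sum_bounds_of_notMem_min {V : Finset (Fin N)} {a m : Fin N} (ha : ∀ x ∈ V, x < a)
    (hm : m ∈ V) (hmin : ∀ x ∈ V, m ≤ x)
    {s t : Finset (Finset (Fin N))} {g h : Finset (Fin N) → ℝ} (hg : IsWeight (insert a V) g)
    (hh : IsWeight (insert a V) h) (hst : CrossInt s t) (hs : IsShifted (insert a V) s)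
    (ht : t ⊆ (insert a V).powerset)
    {X Y : Finset (Fin N)} (hXV : X ⊆ V) (hYV : Y ⊆ V) (hX : insert a X ∈ s)
    (hY : insert a Y ∈ t) (hXY : Disjoint X Y) (hmX : m ∉ X) :
    3 * g (insert a X) ≤ ∑ Z ∈ s, g Z ∨
      2 * g (insert a X) ≤ ∑ Z ∈ s, g Z ∧ ∑ Z ∈ t, h Z ≤ h (insert a Y) := by
  have haX : a ∉ X := fun h => (ha a (hXV h)).false
  have haV : a ∉ V := fun h => (ha a h).false
  have hma := ha m hm
  have h1 : insert m X ∈ s := by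
    have h1 := hs _ hX m (Finset.mem_insert_of_mem hm) a (ha m hm)
      (by simp [hmX, (ha m hm).ne]) (Finset.mem_insert_self _ _)
    rwa [Finset.erase_insert haX] at h1
  have hg1 : g (insert a X) ≤ g (insert m X) :=
    hg.replace X (hXV.trans (Finset.subset_insert _ _)) m (Finset.mem_insert_of_mem hm) a
      (Finset.mem_insert_self _ _) hma hmX haX
  have hne : insert a X ≠ insert m X := by
    intro h
    have : a ∈ insert m X := h ▸ Finset.mem_insert_self a X
    simp [haX, hma.ne'] at this
  rcases X.eq_empty_or_nonempty with rfl | ⟨x, hx⟩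
  · right
    constructor
    · have : ∑ Z ∈ {insert a ∅, insert m ∅}, g Z ≤ ∑ Z ∈ s, g Z :=
        Finset.sum_le_sum_of_subset_of_nonneg (by
          intro Z hZ
          simp only [Finset.mem_insert, Finset.mem_singleton] at hZ
          rcases hZ with rfl | rfl <;> assumption) fun Z _ _ => hg.nonneg Z
      rw [Finset.sum_pair hne] at this
      linarith
    · have hsub : t ⊆ {insert a Y} := by
        intro Z hZ
        rw [Finset.mem_singleton]
        exact hs.eq_insert_of_disjoint ha hst ht hXV hYV hX hY hXY hZ (Finset.disjoint_empty_left _)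
      exact (Finset.sum_le_sum_of_subset_of_nonneg hsub fun Z _ _ => hh.nonneg Z).trans
        (by simp)
  · left
    have hmx : m < x := lt_of_le_of_ne (hmin x (hXV hx)) fun h => hmX (h ▸ hx)
    have hxa : x ≠ a := (ha x (hXV hx)).ne
    have h2 := hs _ hX m (Finset.mem_insert_of_mem hm) x hmx
      (by simp [hmX, (ha m hm).ne]) (Finset.mem_insert_of_mem hx)
    have hg2 : g (insert a X) ≤ g (insert m ((insert a X).erase x)) := by
      have := hg.replace ((insert a X).erase x)
        ((Finset.erase_subset _ _).trans (Finset.insert_subset_insert _ hXV)) m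
        (Finset.mem_insert_of_mem hm) x (Finset.mem_insert_of_mem (hXV hx)) hmx
        (by simp [hmX, (ha m hm).ne]) (Finset.notMem_erase _ _)
      rwa [Finset.insert_erase (Finset.mem_insert_of_mem hx)] at this
    have hne2 : insert a X ≠ insert m ((insert a X).erase x) := by
      intro h
      have : m ∈ insert a X := h ▸ Finset.mem_insert_self _ _
      simp [hmX, hma.ne] at this
    have hne3 : insert m X ≠ insert m ((insert a X).erase x) := by
      intro h
      have : a ∈ insert m X := h ▸ by simp [hxa.symm]
      simp [haX, hma.ne'] at this
    have : ∑ Z ∈ {insert a X, insert m X, insert m ((insert a X).erase x)}, g Z ≤ ∑ Z ∈ s, g Z :=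
      Finset.sum_le_sum_of_subset_of_nonneg (by
        intro Z hZ
        simp only [Finset.mem_insert, Finset.mem_singleton] at hZ
        rcases hZ with rfl | rfl | rfl <;> assumption) fun Z _ _ => hg.nonneg Z
    rw [Finset.sum_insert (by simp [hne, hne2]), Finset.sum_pair hne3] at this
    linarith

/-- The set `insert a Y` is the only member of `t` disjoint from `X`. Deleting it allows `X` to join
`s`, and `X` weighs at least twice as much as `insert a X`. -/
theorem sum_mul_sum_move {V : Finset (Fin N)} {a : Fin N} (ha : ∀ x ∈ V, x < a)
    {s t : Finset (Finset (Fin N))} {g h : Finset (Fin N) → ℝ} (hg : IsWeight (insert a V) g)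
    (hh : IsWeight (insert a V) h) (hst : CrossInt s t) (hs : IsShifted (insert a V) s)
    (hs' : s ⊆ (insert a V).powerset) (ht : t ⊆ (insert a V).powerset)
    (hmax : ∀ s' t', s' ⊆ (insert a V).powerset → t' ⊆ (insert a V).powerset → CrossInt s' t' →
      (∑ X ∈ s', g X) * ∑ X ∈ t', h X ≤ (∑ X ∈ s, g X) * ∑ X ∈ t, h X)
    {X Y : Finset (Fin N)} (hXV : X ⊆ V) (hYV : Y ⊆ V) (hX : insert a X ∈ s)
    (hY : insert a Y ∈ t) (hXY : Disjoint X Y) :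
    (∑ Z ∈ s, g Z + 2 * g (insert a X)) * (∑ Z ∈ t, h Z - h (insert a Y)) ≤
      (∑ X ∈ s, g X) * ∑ X ∈ t, h X := by
  have haX : a ∉ X := fun h => (ha a (hXV h)).false
  have hXs : X ∉ s := fun h =>
    hst _ h _ hY (Finset.disjoint_insert_right.mpr ⟨haX, hXY⟩)
  have h1 := hmax (insert X s) (t.erase (insert a Y))
    (Finset.insert_subset (Finset.mem_powerset.mpr (hXV.trans (Finset.subset_insert _ _))) hs')
    ((Finset.erase_subset _ _).trans ht) ?_
  · rw [Finset.sum_insert hXs, Finset.sum_erase_eq_sub hY] at h1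
    refine le_trans (mul_le_mul_of_nonneg_right ?_ ?_) h1
    · have := hg.halve X (hXV.trans (Finset.subset_insert _ _)) a (Finset.mem_insert_self _ _) haX
      linarith
    · rw [← Finset.sum_erase_eq_sub hY]
      exact Finset.sum_nonneg fun Z _ => hh.nonneg Z
  · intro Z hZ W hW hd
    rw [Finset.mem_erase] at hW
    rcases Finset.mem_insert.mp hZ with rfl | hZ
    · exact hW.1 (hs.eq_insert_of_disjoint ha hst ht hXV hYV hX hY hXY hW.2 hd)
    · exact hst _ hZ _ hW.2 hd

/-- The two trades give `2αH ≤ βG + 2αβ` and `2βG ≤ αH + 2αβ`, hence `G ≤ 2α`, against `3α ≤ G`. If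
instead `H ≤ β`, the second alone gives `2G ≤ 3α`, against `2α ≤ G`. -/
theorem false_of_moves {α β G H : ℝ} (hα : 0 < α) (hβ : 0 < β)
    (h : 3 * α ≤ G ∨ 2 * α ≤ G ∧ H ≤ β) (h1 : (G + 2 * α) * (H - β) ≤ G * H)
    (h2 : (G - α) * (H + 2 * β) ≤ G * H) : False := by
  have hαβ := mul_pos hα hβ
  rcases h with h | ⟨h, h'⟩
  · have := mul_le_mul_of_nonneg_right h hβ.le
    nlinarith
  · have h3 := mul_le_mul_of_nonneg_right h hβ.le
    have h4 := mul_le_mul_of_nonneg_left h' hα.le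
    nlinarith

/-- In a pair of shifted families of maximum product, the links of the last element cross-intersect
(up to sets of weight zero). -/
theorem crossInt_link {V : Finset (Fin N)} {a m : Fin N} (ha : ∀ x ∈ V, x < a)
    (hm : m ∈ V) (hmin : ∀ x ∈ V, m ≤ x)
    {s t : Finset (Finset (Fin N))} {g h : Finset (Fin N) → ℝ} (hg : IsWeight (insert a V) g)
    (hh : IsWeight (insert a V) h) (hst : CrossInt s t) (hs : IsShifted (insert a V) s)
    (ht : IsShifted (insert a V) t)
    (hs' : s ⊆ (insert a V).powerset) (ht' : t ⊆ (insert a V).powerset)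
    (hmax : ∀ s' t', s' ⊆ (insert a V).powerset → t' ⊆ (insert a V).powerset → CrossInt s' t' →
      (∑ X ∈ s', g X) * ∑ X ∈ t', h X ≤ (∑ X ∈ s, g X) * ∑ X ∈ t, h X) :
    CrossInt (V.powerset.filter fun X => insert a X ∈ s ∧ 0 < g (insert a X))
      (V.powerset.filter fun X => insert a X ∈ t ∧ 0 < h (insert a X)) := by
  intro X hX Y hY hXY
  simp only [Finset.mem_filter, Finset.mem_powerset] at hX hY
  obtain ⟨hXV, hX, hα⟩ := hX
  obtain ⟨hYV, hY, hβ⟩ := hY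
  have h1 := sum_mul_sum_move ha hg hh hst hs hs' ht' hmax hXV hYV hX hY hXY
  have h2 := sum_mul_sum_move ha hh hg hst.symm ht ht' hs'
    (fun s' t' h1 h2 h3 => by
      rw [mul_comm, mul_comm (∑ X ∈ t, h X)]
      exact hmax t' s' h2 h1 h3.symm) hYV hXV hY hX hXY.symm
  -- Disjoint `X` and `Y` cannot both contain `m`; the one that avoids it plays the role of `X` in
  -- `sum_bounds_of_notMem_min`.
  by_cases hmX : m ∈ X
  · have hmY : m ∉ Y := Finset.disjoint_left.mp hXY hmX
    refine false_of_moves hβ hα (sum_bounds_of_notMem_min ha hm hmin hh hg hst.symm ht hs'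
      hYV hXV hY hX hXY.symm hmY) h2 ?_
    linarith
  · refine false_of_moves hα hβ (sum_bounds_of_notMem_min ha hm hmin hg hh hst hs ht'
      hXV hYV hX hY hXY hmX) h1 ?_
    linarith

/-- Equality is needed only for the product of the parts without `a`: a singleton found there
already belongs to the full families. -/
theorem eq_and_eq_of_add_eq_add {a b c d a' b' c' d' : ℝ} (h1 : a * c ≤ a' * c')
    (h2 : a * d ≤ a' * d') (h3 : b * c ≤ b' * c') (h4 : b * d ≤ b' * d') :
    (a + b) * (c + d) ≤ (a' + b') * (c' + d') ∧
      ((a + b) * (c + d) = (a' + b') * (c' + d') → a * c = a' * c') := by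
  constructor
  · nlinarith
  · intro h
    nlinarith

/-- The bound for `s` and `t`, with the case of equality. -/
def StarBound (V : Finset (Fin N)) (m : Fin N) (g h : Finset (Fin N) → ℝ)
    (s t : Finset (Finset (Fin N))) : Prop :=
  (∑ X ∈ s, g X) * ∑ X ∈ t, h X ≤ (∑ X ∈ setStar V m, g X) * ∑ X ∈ setStar V m, h X ∧
    (0 < g {m} → 0 < h {m} →
      (∑ X ∈ s, g X) * ∑ X ∈ t, h X = (∑ X ∈ setStar V m, g X) * ∑ X ∈ setStar V m, h X →
      ∃ p, {p} ∈ s ∧ {p} ∈ t)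

theorem starBound_singleton {m : Fin N} {g h : Finset (Fin N) → ℝ} (hg : IsWeight {m} g)
    (hh : IsWeight {m} h) {s t : Finset (Finset (Fin N))} (hs : s ⊆ ({m} : Finset _).powerset)
    (ht : t ⊆ ({m} : Finset _).powerset) (hst : CrossInt s t) : StarBound {m} m g h s t := by
  have hstar : setStar {m} m = {{m}} := by
    ext X
    simp only [setStar, Finset.mem_filter, Finset.mem_powerset, Finset.mem_singleton,
      Finset.subset_singleton_iff]
    constructor
    · rintro ⟨rfl | rfl, h⟩
      · simp at h
      · rfl
    · rintro rfl
      simp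
  rw [StarBound, hstar, Finset.sum_singleton, Finset.sum_singleton]
  rcases s.eq_empty_or_nonempty with rfl | ⟨X, hX⟩
  · simp only [Finset.sum_empty, zero_mul]
    exact ⟨mul_nonneg (hg.nonneg _) (hh.nonneg _), fun h1 h2 h => absurd h (mul_pos h1 h2).ne⟩
  rcases t.eq_empty_or_nonempty with rfl | ⟨Y, hY⟩
  · simp only [Finset.sum_empty, mul_zero]
    exact ⟨mul_nonneg (hg.nonneg _) (hh.nonneg _), fun h1 h2 h => absurd h (mul_pos h1 h2).ne⟩
  have hs1 : s ⊆ {{m}} := by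
    intro Z hZ
    rcases Finset.subset_singleton_iff.mp (Finset.mem_powerset.mp (hs hZ)) with rfl | rfl
    · exact absurd (Finset.disjoint_empty_left _) (hst _ hZ _ hY)
    · simp
  have ht1 : t ⊆ {{m}} := by
    intro Z hZ
    rcases Finset.subset_singleton_iff.mp (Finset.mem_powerset.mp (ht hZ)) with rfl | rfl
    · exact absurd (Finset.disjoint_empty_right _) (hst _ hX _ hZ)
    · simp
  have hs2 : s = {{m}} :=
    (Finset.subset_singleton_iff.mp hs1).resolve_left (Finset.ne_empty_of_mem hX)
  have ht2 : t = {{m}} :=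
    (Finset.subset_singleton_iff.mp ht1).resolve_left (Finset.ne_empty_of_mem hY)
  subst hs2 ht2
  simp only [Finset.sum_singleton, le_refl, true_and]
  exact fun _ _ _ => ⟨m, by simp, by simp⟩

theorem starBound_insert_of_isShifted {V : Finset (Fin N)} {a m : Fin N} (ha : ∀ x ∈ V, x < a)
    (hm : m ∈ V) (hmin : ∀ x ∈ V, m ≤ x)
    (ih : ∀ g h, IsWeight V g → IsWeight V h → ∀ s t, s ⊆ V.powerset → t ⊆ V.powerset →
      CrossInt s t → StarBound V m g h s t)
    {s t : Finset (Finset (Fin N))} {g h : Finset (Fin N) → ℝ} (hg : IsWeight (insert a V) g)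
    (hh : IsWeight (insert a V) h) (hst : CrossInt s t) (hs : IsShifted (insert a V) s)
    (ht : IsShifted (insert a V) t)
    (hs' : s ⊆ (insert a V).powerset) (ht' : t ⊆ (insert a V).powerset)
    (hmax : ∀ s' t', s' ⊆ (insert a V).powerset → t' ⊆ (insert a V).powerset → CrossInt s' t' →
      (∑ X ∈ s', g X) * ∑ X ∈ t', h X ≤ (∑ X ∈ s, g X) * ∑ X ∈ t, h X) :
    StarBound (insert a V) m g h s t := by
  have haV : a ∉ V := fun h => (ha a h).false
  have hg0 := hg.mono (Finset.subset_insert a V)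
  have hh0 := hh.mono (Finset.subset_insert a V)
  have hg1 := hg.insert haV
  have hh1 := hh.insert haV
  have h00 := ih g h hg0 hh0 (V.powerset.filter (· ∈ s)) (V.powerset.filter (· ∈ t))
    (Finset.filter_subset _ _) (Finset.filter_subset _ _) fun X hX Y hY =>
      hst X (Finset.mem_filter.mp hX).2 Y (Finset.mem_filter.mp hY).2
  have h01 := ih g _ hg0 hh1 (V.powerset.filter (· ∈ s))
    (V.powerset.filter fun X => insert a X ∈ t ∧ 0 < h (insert a X))
    (Finset.filter_subset _ _) (Finset.filter_subset _ _) (by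
      intro X hX Y hY hd
      simp only [Finset.mem_filter, Finset.mem_powerset] at hX hY
      exact hst X hX.2 _ hY.2.1 (Finset.disjoint_insert_right.mpr
        ⟨fun h => haV (hX.1 h), hd⟩))
  have h10 := ih _ h hg1 hh0 (V.powerset.filter fun X => insert a X ∈ s ∧ 0 < g (insert a X))
    (V.powerset.filter (· ∈ t))
    (Finset.filter_subset _ _) (Finset.filter_subset _ _) (by
      intro X hX Y hY hd
      simp only [Finset.mem_filter, Finset.mem_powerset] at hX hY
      exact hst _ hX.2.1 _ hY.2 (Finset.disjoint_insert_left.mpr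
        ⟨fun h => haV (hY.1 h), hd⟩))
  have h11 := ih _ _ hg1 hh1 _ _ (Finset.filter_subset _ _) (Finset.filter_subset _ _)
    (crossInt_link ha hm hmin hg hh hst hs ht hs' ht' hmax)
  have key := eq_and_eq_of_add_eq_add h00.1 h01.1 h10.1 h11.1
  rw [← sum_eq_add_of_subset_powerset_insert haV hs' hg.nonneg,
    ← sum_eq_add_of_subset_powerset_insert haV ht' hh.nonneg,
    ← sum_setStar_insert haV hm, ← sum_setStar_insert haV hm] at key
  refine ⟨key.1, fun hgm hhm heq => ?_⟩
  obtain ⟨p, hp1, hp2⟩ := h00.2 hgm hhm (key.2 heq)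
  exact ⟨p, (Finset.mem_filter.mp hp1).2, (Finset.mem_filter.mp hp2).2⟩

theorem sum_le_sum_compr_shift {V : Finset (Fin N)} {g : Finset (Fin N) → ℝ} (hg : IsWeight V g)
    (x : Fin N × Fin N) {s : Finset (Finset (Fin N))} (hs : s ⊆ V.powerset) :
    ∑ X ∈ s, g X ≤ ∑ X ∈ compr (shift V x) s, g X := by
  rw [sum_compr (shift_inj x)]
  refine Finset.sum_le_sum fun X hX => ?_
  split_ifs
  · exact le_rfl
  · exact hg.le_shift x (Finset.mem_powerset.mp (hs hX))

theorem compr_shift_subset {V : Finset (Fin N)} (x : Fin N × Fin N)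
    {s : Finset (Finset (Fin N))} (hs : s ⊆ V.powerset) : compr (shift V x) s ⊆ V.powerset := by
  intro X hX
  rcases mem_compr.mp hX with h | ⟨Y, hY, -, rfl⟩
  · exact hs h.1
  · exact Finset.mem_powerset.mpr (shift_subset x (Finset.mem_powerset.mp (hs hY)))

theorem singleton_mem_of_mem_compr_shift {V : Finset (Fin N)} {x : Fin N × Fin N}
    {s : Finset (Finset (Fin N))} {p : Fin N} (h : {p} ∈ compr (shift V x) s) :
    {p} ∈ s ∨ p = x.1 ∧ {x.2} ∈ s := by
  rcases mem_compr.mp h with h | ⟨Y, hY, hY', h⟩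
  · exact Or.inl h.1
  · right
    obtain ⟨⟨-, -, h1, h2⟩, h3⟩ := shift_ne (V := V) (x := x) (X := Y) fun h => hY' (h.symm ▸ hY)
    rw [h3] at h
    have hp : x.1 = p := by
      rw [← Finset.mem_singleton, ← h]
      exact Finset.mem_insert_self _ _
    refine ⟨hp.symm, ?_⟩
    have : Y = {x.2} := by
      ext y
      rw [Finset.mem_singleton]
      constructor
      · intro hy
        by_contra hne
        have : y ∈ ({p} : Finset (Fin N)) := h ▸ by simp [hne, hy]
        rw [Finset.mem_singleton, ← hp] at this
        exact h1 (this ▸ hy)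
      · rintro rfl
        exact h2
    rwa [← this]

theorem CrossInt.singleton_eq {s t : Finset (Finset (Fin N))} (hst : CrossInt s t) {p q : Fin N}
    (hp : {p} ∈ s) (hq : {q} ∈ t) : p = q := by
  by_contra h
  exact hst _ hp _ hq (by simpa using h)

/-- Each compressed family that contains a singleton comes from a family that contains one, possibly
a different one; cross-intersection forces the two original singletons to coincide. -/
theorem exists_singleton_of_compr_shift {V : Finset (Fin N)} {x : Fin N × Fin N}
    {s t : Finset (Finset (Fin N))} (hst : CrossInt s t)
    (h : ∃ p, {p} ∈ compr (shift V x) s ∧ {p} ∈ compr (shift V x) t) :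
    ∃ p, {p} ∈ s ∧ {p} ∈ t := by
  obtain ⟨p, hp, hq⟩ := h
  rcases singleton_mem_of_mem_compr_shift hp with hp | ⟨-, hp⟩ <;>
    rcases singleton_mem_of_mem_compr_shift hq with hq | ⟨-, hq⟩ <;>
    exact ⟨_, hp, (hst.singleton_eq hp hq).symm ▸ hq⟩

theorem starBound_insert_of_max {V : Finset (Fin N)} {a m : Fin N} (ha : ∀ x ∈ V, x < a)
    (hm : m ∈ V) (hmin : ∀ x ∈ V, m ≤ x)
    (ih : ∀ g h, IsWeight V g → IsWeight V h → ∀ s t, s ⊆ V.powerset → t ⊆ V.powerset →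
      CrossInt s t → StarBound V m g h s t)
    {g h : Finset (Fin N) → ℝ} (hg : IsWeight (insert a V) g) (hh : IsWeight (insert a V) h)
    (s t : Finset (Finset (Fin N))) (hst : CrossInt s t) :
    s ⊆ (insert a V).powerset → t ⊆ (insert a V).powerset →
    (∀ s' t', s' ⊆ (insert a V).powerset → t' ⊆ (insert a V).powerset → CrossInt s' t' →
      (∑ X ∈ s', g X) * ∑ X ∈ t', h X ≤ (∑ X ∈ s, g X) * ∑ X ∈ t, h X) →
    StarBound (insert a V) m g h s t := by
  refine compr_induction (f := shift (insert a V)) (R := fun X Y => ¬ Disjoint X Y)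
    (fun X => ∑ i ∈ X, (i : ℕ)) shift_inj sum_val_shift_lt
    (fun X Y h h' => h h'.symm) not_disjoint_shift_shift not_disjoint_shift_left
    (P := fun s t => s ⊆ (insert a V).powerset → t ⊆ (insert a V).powerset →
      (∀ s' t', s' ⊆ (insert a V).powerset → t' ⊆ (insert a V).powerset → CrossInt s' t' →
        (∑ X ∈ s', g X) * ∑ X ∈ t', h X ≤ (∑ X ∈ s, g X) * ∑ X ∈ t, h X) →
      StarBound (insert a V) m g h s t) ?_ ?_ s t hst
  · intro s t hst hs ht hs' ht' hmax
    have key : ∀ u : Finset (Finset (Fin N)), (∀ x, ∀ X ∈ u, shift (insert a V) x X ∈ u) →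
        IsShifted (insert a V) u := by
      intro u hu X hX i hi j hij hiX hjX
      have := hu (i, j) X hX
      rwa [shift, if_pos ⟨hij, hi, hiX, hjX⟩] at this
    exact starBound_insert_of_isShifted ha hm hmin ih hg hh hst (key s hs) (key t ht) hs' ht' hmax
  · intro x s t hst hP hs ht hmax
    have hcs := compr_shift_subset x hs
    have hct := compr_shift_subset x ht
    have hle : (∑ X ∈ s, g X) * ∑ X ∈ t, h X ≤
        (∑ X ∈ compr (shift (insert a V) x) s, g X) *
          ∑ X ∈ compr (shift (insert a V) x) t, h X :=
      mul_le_mul (sum_le_sum_compr_shift hg x hs) (sum_le_sum_compr_shift hh x ht)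
        (Finset.sum_nonneg fun Z _ => hh.nonneg Z) (Finset.sum_nonneg fun Z _ => hg.nonneg Z)
    -- A shift cannot decrease the product and maximality forbids an increase, so the equality case
    -- passes back through the shift.
    have heq := le_antisymm hle (hmax _ _ hcs hct (cross_compr (fun X Y h h' => h h'.symm)
      (not_disjoint_shift_shift x) (not_disjoint_shift_left x) hst))
    obtain ⟨h1, h2⟩ := hP hcs hct (fun s' t' h1 h2 h3 => (hmax s' t' h1 h2 h3).trans hle)
    rw [← heq] at h1 h2
    exact ⟨h1, fun hgm hhm h => exists_singleton_of_compr_shift hst (h2 hgm hhm h)⟩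

theorem exists_max_crossInt (V : Finset (Fin N)) (g h : Finset (Fin N) → ℝ) :
    ∃ s t, s ⊆ V.powerset ∧ t ⊆ V.powerset ∧ CrossInt s t ∧
      ∀ s' t', s' ⊆ V.powerset → t' ⊆ V.powerset → CrossInt s' t' →
        (∑ X ∈ s', g X) * ∑ X ∈ t', h X ≤ (∑ X ∈ s, g X) * ∑ X ∈ t, h X := by
  classical
  obtain ⟨p, hp, hmax⟩ := Finset.exists_max_image
    ((V.powerset.powerset ×ˢ V.powerset.powerset).filter fun p => CrossInt p.1 p.2)
    (fun p => (∑ X ∈ p.1, g X) * ∑ X ∈ p.2, h X) ⟨(∅, ∅), by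
      rw [Finset.mem_filter]
      exact ⟨by simp, fun X hX => by simp at hX⟩⟩
  simp only [Finset.mem_filter, Finset.mem_product, Finset.mem_powerset] at hp hmax
  exact ⟨p.1, p.2, hp.1.1, hp.1.2, hp.2, fun s' t' h1 h2 h3 => hmax (s', t') ⟨⟨h1, h2⟩, h3⟩⟩

/-- The weighted cross-intersection theorem. -/
theorem starBound_of_crossInt {V : Finset (Fin N)} {m : Fin N} (hm : m ∈ V)
    (hmin : ∀ x ∈ V, m ≤ x) {g h : Finset (Fin N) → ℝ} (hg : IsWeight V g) (hh : IsWeight V h)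
    {s t : Finset (Finset (Fin N))} (hs : s ⊆ V.powerset) (ht : t ⊆ V.powerset)
    (hst : CrossInt s t) : StarBound V m g h s t := by
  induction V using Finset.induction_on_max generalizing g h s t with
  | empty => simp at hm
  | insert a V ha ih =>
    rcases V.eq_empty_or_nonempty with rfl | ⟨b, hb⟩
    · have : m = a := by simpa using hm
      subst this
      exact starBound_singleton hg hh hs ht hst
    · have hmV : m ∈ V := by
        refine Finset.mem_of_mem_insert_of_ne hm fun h => ?_
        have := hmin b (Finset.mem_insert_of_mem hb)
        exact absurd (ha b hb) (not_lt.mpr (h ▸ this))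
      have hminV : ∀ x ∈ V, m ≤ x := fun x hx => hmin x (Finset.mem_insert_of_mem hx)
      have ih' : ∀ g h, IsWeight V g → IsWeight V h → ∀ s t, s ⊆ V.powerset → t ⊆ V.powerset →
          CrossInt s t → StarBound V m g h s t :=
        fun g h hg hh s t hs ht hst => ih hmV hminV hg hh hs ht hst
      obtain ⟨s₀, t₀, hs₀, ht₀, hst₀, hmax⟩ := exists_max_crossInt (insert a V) g h
      have hbound := (starBound_insert_of_max ha hmV hminV ih' hg hh s₀ t₀ hst₀ hs₀ ht₀ hmax).1
      refine ⟨(hmax s t hs ht hst).trans hbound, fun hgm hhm heq => ?_⟩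
      -- A pair that attains the bound is itself of maximum product.
      refine (starBound_insert_of_max ha hmV hminV ih' hg hh s t hst hs ht ?_).2 hgm hhm heq
      intro s' t' h1 h2 h3
      rw [heq]
      exact (hmax s' t' h1 h2 h3).trans hbound

end Weighted

/-! ### From sequences to the sets of positions of their 1s. -/

section Sequences

variable {N : ℕ}

/-- The positions of the nonzero entries. -/
def supp (a : Fin N → ℕ) : Finset (Fin N) :=
  Finset.univ.filter fun i => a i ≠ 0

/-- The positions of the entries equal to `1`. -/
def ones (a : Fin N → ℕ) : Finset (Fin N) :=
  Finset.univ.filter fun i => a i = 1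

theorem mem_supp {a : Fin N → ℕ} {i : Fin N} : i ∈ supp a ↔ a i ≠ 0 := by
  simp [supp]

theorem mem_ones {a : Fin N → ℕ} {i : Fin N} : i ∈ ones a ↔ a i = 1 := by
  simp [ones]

theorem mem_S {c : Fin N → ℕ} {r : ℕ} {a : Fin N → ℕ} :
    a ∈ S c r ↔ (∀ i, a i ≤ c i) ∧ (supp a).card = r := by
  simp [S, supp]

theorem mem_star {c : Fin N → ℕ} {r : ℕ} {p : Fin N} {q : ℕ} {a : Fin N → ℕ} :
    a ∈ star c r p q ↔ a ∈ S c r ∧ a p = q := by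
  simp [star]

theorem supp_update {a : Fin N → ℕ} {i : Fin N} {v : ℕ} (ha : a i ≠ 0) (hv : v ≠ 0) :
    supp (Function.update a i v) = supp a := by
  ext j
  rw [mem_supp, mem_supp]
  by_cases h : j = i
  · subst h
    simp [ha, hv]
  · simp [h]

theorem update_mem_S {c : Fin N → ℕ} {r : ℕ} {a : Fin N → ℕ} (ha : a ∈ S c r) {i : Fin N}
    {v : ℕ} (hi : a i ≠ 0) (hv : v ≠ 0) (hvc : v ≤ c i) : Function.update a i v ∈ S c r := by
  rw [mem_S] at ha ⊢
  rw [supp_update hi hv]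
  refine ⟨fun j => ?_, ha.2⟩
  by_cases h : j = i
  · subst h
    simpa using hvc
  · simpa [h] using ha.1 j

theorem card_supp_comp_equiv (a : Fin N → ℕ) (e : Fin N ≃ Fin N) :
    (supp (a ∘ e)).card = (supp a).card :=
  Finset.card_bijective e e.bijective fun i => by simp [mem_supp]

/-- The entry of position `p'` fits in position `p` because `c p' ≤ c p`. Only the constant entry
`q` is overwritten, which makes the map injective (`swap_update_injOn`). -/
theorem swap_update_mem_star {c : Fin N → ℕ} {r : ℕ} {p p' : Fin N} {q q' : ℕ}
    (hpp : c p' ≤ c p) (hq : 1 ≤ q) (hq' : 1 ≤ q') (hqc : q' ≤ c p') {a : Fin N → ℕ}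
    (ha : a ∈ star c r p q) :
    Function.update (a ∘ Equiv.swap p p') p' q' ∈ star c r p' q' := by
  rw [mem_star, mem_S] at ha
  rw [mem_star, mem_S]
  obtain ⟨⟨h1, h2⟩, h3⟩ := ha
  refine ⟨⟨fun i => ?_, ?_⟩, by simp⟩
  · by_cases h : i = p'
    · subst h
      simpa using hqc
    · rw [Function.update_of_ne h, Function.comp_apply]
      by_cases h' : i = p
      · subst h'
        rw [Equiv.swap_apply_left]
        exact (h1 _).trans hpp
      · rw [Equiv.swap_apply_of_ne_of_ne h' h]
        exact h1 i
  · rw [supp_update (by simp; omega) (by omega), card_supp_comp_equiv, h2]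

theorem swap_update_injOn {c : Fin N → ℕ} {r : ℕ} {p p' : Fin N} {q q' : ℕ} :
    Set.InjOn (fun a : Fin N → ℕ => Function.update (a ∘ Equiv.swap p p') p' q')
      (star c r p q : Set (Fin N → ℕ)) := by
  intro a ha b hb hab
  have ha' := (mem_star.mp ha).2
  have hb' := (mem_star.mp hb).2
  funext l
  by_cases h : l = p
  · rw [h, ha', hb']
  · have h' : Equiv.swap p p' l ≠ p' := fun h' => h <| by
      have := congrArg (Equiv.swap p p') h'
      simpa using this
    have := congrFun hab (Equiv.swap p p' l)
    simpa [Function.update_of_ne h'] using this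

theorem card_star_le {c : Fin N → ℕ} {r : ℕ} {p p' : Fin N} {q q' : ℕ}
    (hpp : c p' ≤ c p) (hq : 1 ≤ q) (hq' : 1 ≤ q') (hqc : q' ≤ c p') :
    (star c r p q).card ≤ (star c r p' q').card :=
  Finset.card_le_card_of_injOn _ (fun _ ha => swap_update_mem_star hpp hq hq' hqc ha)
    swap_update_injOn

/-- The bounds are at least `3` up to some position, weakly increasing there, and `0` after it. -/
def Capped (c : Fin N → ℕ) : Prop :=
  ∀ i j, i ≤ j → c j ≠ 0 → 3 ≤ c i ∧ c i ≤ c j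

theorem Capped.card_star_le_zero [NeZero N] {c : Fin N → ℕ} (hc : Capped c) (r : ℕ) (p : Fin N)
    {q : ℕ} (hq : 1 ≤ q) : (star c r p q).card ≤ (star c r 0 1).card := by
  by_cases h : c p = 0
  · have : star c r p q = ∅ := by
      rw [Finset.eq_empty_iff_forall_notMem]
      intro a ha
      rw [mem_star, mem_S] at ha
      have := ha.1.1 p
      omega
    simp [this]
  · have := hc 0 p (Fin.zero_le p) h
    exact card_star_le this.2 hq le_rfl (by omega)

/-- The number of sequences whose entries equal to `1` are in the positions `X`. -/
def weight (c : Fin N → ℕ) (r : ℕ) (X : Finset (Fin N)) : ℕ :=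
  ((S c r).filter fun a => ones a = X).card

theorem Capped.weight_halve {c : Fin N → ℕ} (hc : Capped c) (r : ℕ) {X : Finset (Fin N)}
    {y : Fin N} (hy : y ∉ X) : 2 * weight c r (insert y X) ≤ weight c r X := by
  have h2 : ({2, 3} : Finset ℕ).card = 2 := rfl
  unfold weight
  rw [mul_comm]
  -- The factor 2 counts the values 2 and 3 that can replace the 1 in position `y`; this is where
  -- bounds of at least 3 enter.
  nth_rw 1 [← h2]
  rw [← Finset.card_product]
  refine Finset.card_le_card_of_injOn (fun p => Function.update p.1 y p.2) ?_ ?_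
  · rintro ⟨a, v⟩ h
    simp only [Finset.coe_product, Set.mem_prod, Finset.mem_coe, Finset.mem_filter,
      Finset.mem_insert, Finset.mem_singleton] at h ⊢
    obtain ⟨⟨ha, hX⟩, hv⟩ := h
    have hay : a y = 1 := by
      rw [← mem_ones, hX]
      exact Finset.mem_insert_self _ _
    have hcy : 3 ≤ c y := by
      have := (mem_S.mp ha).1 y
      exact (hc y y le_rfl (by omega)).1
    refine ⟨update_mem_S ha (by omega) (by omega) (by omega), ?_⟩
    ext i
    rw [mem_ones]
    by_cases h : i = y
    · subst h
      simp only [Function.update_self, hy, iff_false]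
      omega
    · rw [Function.update_of_ne h, ← mem_ones, hX]
      simp [h]
  · rintro ⟨a, v⟩ h ⟨b, w⟩ h' hab
    simp only [Finset.coe_product, Set.mem_prod, Finset.mem_coe, Finset.mem_filter] at h h'
    have hay : a y = 1 := by
      rw [← mem_ones, h.1.2]
      exact Finset.mem_insert_self _ _
    have hby : b y = 1 := by
      rw [← mem_ones, h'.1.2]
      exact Finset.mem_insert_self _ _
    simp only at hab
    have hvw : v = w := by simpa using congrFun hab y
    have : a = b := by
      funext i
      by_cases h : i = y
      · rw [h, hay, hby]
      · simpa [h] using congrFun hab i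
    rw [hvw, this]

/-- Entries `i` and `j` are exchanged: the 1 moves to `i`, and the old entry of `i` fits in position
`j` since `c i ≤ c j`. -/
theorem Capped.weight_replace {c : Fin N → ℕ} (hc : Capped c) (r : ℕ) {Z : Finset (Fin N)}
    {i j : Fin N} (hij : i < j) (hi : i ∉ Z) (hj : j ∉ Z) :
    weight c r (insert j Z) ≤ weight c r (insert i Z) := by
  unfold weight
  refine Finset.card_le_card_of_injOn (fun a => a ∘ Equiv.swap i j) ?_ ?_
  · intro a h
    simp only [Finset.mem_coe, Finset.mem_filter] at h ⊢
    obtain ⟨ha, hX⟩ := h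
    have haj : a j = 1 := by
      rw [← mem_ones, hX]
      exact Finset.mem_insert_self _ _
    rw [mem_S] at ha
    have hcj := ha.1 j
    have hcij := hc i j hij.le (by omega)
    refine ⟨mem_S.mpr ⟨fun k => ?_, ?_⟩, ?_⟩
    · rw [Function.comp_apply]
      by_cases hki : k = i
      · subst hki
        rw [Equiv.swap_apply_left]
        omega
      by_cases hkj : k = j
      · subst hkj
        rw [Equiv.swap_apply_right]
        exact (ha.1 i).trans hcij.2
      · rw [Equiv.swap_apply_of_ne_of_ne hki hkj]
        exact ha.1 k
    · rw [card_supp_comp_equiv, ha.2]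
    · ext k
      rw [mem_ones, Function.comp_apply, ← mem_ones, hX]
      by_cases hki : k = i
      · subst hki
        simp
      by_cases hkj : k = j
      · subst hkj
        simp [hij.ne, hij.ne', hi, hj]
      · rw [Equiv.swap_apply_of_ne_of_ne hki hkj]
        simp [hki, hkj]
  · intro a _ b _ hab
    exact (Equiv.swap i j).surjective.injective_comp_right hab

theorem Capped.isWeight {c : Fin N → ℕ} (hc : Capped c) (r : ℕ) :
    IsWeight Finset.univ fun X => (weight c r X : ℝ) :=
  ⟨fun X => Nat.cast_nonneg _, fun X _ y _ hy => by exact_mod_cast hc.weight_halve r hy,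
    fun Z _ i _ j _ hij hi hj => by exact_mod_cast hc.weight_replace r hij hi hj⟩

theorem sum_setStar_weight (c : Fin N → ℕ) (r : ℕ) (p : Fin N) :
    ∑ X ∈ setStar Finset.univ p, (weight c r X : ℝ) = (star c r p 1).card := by
  rw [Finset.card_eq_sum_card_fiberwise (f := ones) (t := setStar Finset.univ p)]
  · push_cast
    refine Finset.sum_congr rfl fun X hX => ?_
    simp only [setStar, Finset.mem_filter] at hX
    rw [weight]
    congr 2
    ext a
    simp only [Finset.mem_filter, mem_star]
    constructor
    · rintro ⟨h1, rfl⟩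
      exact ⟨⟨h1, mem_ones.mp hX.2⟩, rfl⟩
    · rintro ⟨h1, h2⟩
      exact ⟨h1.1, h2⟩
  · intro a ha
    simp only [Finset.mem_coe, mem_star] at ha
    simp [setStar, mem_ones, ha.2]

theorem card_le_sum_weight {c : Fin N → ℕ} {r : ℕ} {A : Finset (Fin N → ℕ)} (hA : A ⊆ S c r) :
    (A.card : ℝ) ≤ ∑ X ∈ A.image ones, (weight c r X : ℝ) := by
  rw [Finset.card_eq_sum_card_image ones A]
  push_cast
  refine Finset.sum_le_sum fun X _ => ?_
  exact_mod_cast Finset.card_le_card (Finset.filter_subset_filter _ hA)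

/-- This supplies the positivity required by the equality case of `StarBound`. -/
theorem weight_singleton_pos [NeZero N] {c : Fin N → ℕ} {r : ℕ} (h1 : 1 ≤ r) (hrN : r ≤ N)
    (hr : ∀ i : Fin N, (i : ℕ) < r → 3 ≤ c i) : 0 < weight c r {0} := by
  rw [weight, Finset.card_pos]
  refine ⟨fun i => if i = 0 then 1 else if (i : ℕ) < r then 2 else 0, ?_⟩
  rw [Finset.mem_filter, mem_S]
  refine ⟨⟨fun i => ?_, ?_⟩, ?_⟩
  · have := hr i
    have h0 := hr 0 (by simp; omega)
    split_ifs with h h'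
    · subst h
      omega
    · have := this h'
      omega
    · omega
  · have : (supp fun i : Fin N => if i = 0 then 1 else if (i : ℕ) < r then 2 else 0) =
        Finset.univ.filter fun i : Fin N => (i : ℕ) < r := by
      ext i
      simp only [mem_supp, Finset.mem_filter, Finset.mem_univ, true_and]
      split_ifs with h h'
      · subst h
        simp
        omega
      · simpa using h'
      · simpa using h'
    rw [this, Fin.card_filter_val_lt]
    omega
  · ext i
    simp only [mem_ones, Finset.mem_singleton]
    split_ifs with h h' <;> simp [h]

/-- The sequences agree on some nonzero entry. -/
def MeetsAt (a b : Fin N → ℕ) : Prop :=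
  ∃ i, a i = b i ∧ a i ≠ 0

/-- Replace the entry `x.2 ≥ 2` in position `x.1` by `1`. -/
def lower (x : Fin N × ℕ) (a : Fin N → ℕ) : Fin N → ℕ :=
  if 2 ≤ x.2 ∧ a x.1 = x.2 then Function.update a x.1 1 else a

theorem lower_ne {x : Fin N × ℕ} {a : Fin N → ℕ} (h : lower x a ≠ a) :
    (2 ≤ x.2 ∧ a x.1 = x.2) ∧ lower x a = Function.update a x.1 1 := by
  unfold lower at h ⊢
  split_ifs at h ⊢ with h1
  · exact ⟨h1, rfl⟩
  · exact absurd rfl h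

theorem lower_apply_of_ne (x : Fin N × ℕ) (a : Fin N → ℕ) {i : Fin N} (h : i ≠ x.1) :
    lower x a i = a i := by
  unfold lower
  split_ifs
  · simp [h]
  · rfl

theorem lower_apply_self (x : Fin N × ℕ) (a : Fin N → ℕ) :
    lower x a x.1 = if 2 ≤ x.2 ∧ a x.1 = x.2 then 1 else a x.1 := by
  unfold lower
  split_ifs <;> simp

theorem lower_inj (x : Fin N × ℕ) (a b : Fin N → ℕ) (ha : lower x a ≠ a) (hb : lower x b ≠ b)
    (h : lower x a = lower x b) : a = b := by
  have ha' := (lower_ne ha).1.2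
  have hb' := (lower_ne hb).1.2
  funext i
  by_cases hi : i = x.1
  · rw [hi, ha', hb']
  · rw [← lower_apply_of_ne x a hi, h, lower_apply_of_ne x b hi]

theorem sum_lower_lt (x : Fin N × ℕ) (a : Fin N → ℕ) (h : lower x a ≠ a) :
    ∑ i, lower x a i < ∑ i, a i := by
  obtain ⟨⟨h1, h2⟩, -⟩ := lower_ne h
  have h3 := lower_apply_self x a
  rw [if_pos ⟨h1, h2⟩] at h3
  refine Finset.sum_lt_sum (fun i _ => ?_) ⟨x.1, Finset.mem_univ _, by omega⟩
  by_cases hi : i = x.1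
  · rw [hi]
    omega
  · rw [lower_apply_of_ne x a hi]

theorem MeetsAt.symm {a b : Fin N → ℕ} (h : MeetsAt a b) : MeetsAt b a := by
  obtain ⟨i, h1, h2⟩ := h
  exact ⟨i, h1.symm, h1 ▸ h2⟩

theorem MeetsAt.lower {a b : Fin N → ℕ} (x : Fin N × ℕ) (h : MeetsAt a b) :
    MeetsAt (lower x a) (lower x b) := by
  obtain ⟨i, h1, h2⟩ := h
  refine ⟨i, ?_⟩
  by_cases hi : i = x.1
  · subst hi
    rw [lower_apply_self, lower_apply_self, h1]
    refine ⟨rfl, ?_⟩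
    split_ifs
    · exact one_ne_zero
    · exact h1 ▸ h2
  · rw [lower_apply_of_ne x a hi, lower_apply_of_ne x b hi]
    exact ⟨h1, h2⟩

theorem MeetsAt.lower_left (x : Fin N × ℕ) (a b : Fin N → ℕ) (ha : IntSeq.lower x a ≠ a)
    (h : MeetsAt a b) (h' : MeetsAt a (IntSeq.lower x b)) : MeetsAt (IntSeq.lower x a) b := by
  obtain ⟨⟨hx, hax⟩, -⟩ := lower_ne ha
  have key : ∀ i, i ≠ x.1 → a i = b i → a i ≠ 0 → MeetsAt (IntSeq.lower x a) b := by
    intro i hi h1 h2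
    refine ⟨i, ?_⟩
    rw [lower_apply_of_ne x a hi]
    exact ⟨h1, h2⟩
  obtain ⟨i, h1, h2⟩ := h
  by_cases hi : i = x.1
  · subst hi
    obtain ⟨j, h3, h4⟩ := h'
    by_cases hj : j = x.1
    · subst hj
      rw [lower_apply_self, if_pos ⟨hx, h1 ▸ hax⟩] at h3
      omega
    · rw [lower_apply_of_ne x b hj] at h3
      exact key j hj h3 h4
  · exact key i hi h1 h2

theorem lower_mem_S {c : Fin N → ℕ} {r : ℕ} (x : Fin N × ℕ) {a : Fin N → ℕ} (ha : a ∈ S c r) :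
    lower x a ∈ S c r := by
  unfold lower
  split_ifs with h
  · have := (mem_S.mp ha).1 x.1
    exact update_mem_S ha (by omega) one_ne_zero (by omega)
  · exact ha

theorem compr_lower_subset {c : Fin N → ℕ} {r : ℕ} (x : Fin N × ℕ) {A : Finset (Fin N → ℕ)}
    (hA : A ⊆ S c r) : compr (lower x) A ⊆ S c r := by
  intro a ha
  rcases mem_compr.mp ha with h | ⟨b, hb, -, rfl⟩
  · exact hA h.1
  · exact lower_mem_S x (hA hb)

/-- If `a` and `b` agree at `i` on a value other than 1, lowering `a` there destroys this agreement
but stays in `A`. Induction on the sum of entries gives a common 1, which is not at `i` and so was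
already present in `a`. -/
theorem exists_one_of_stable {A B : Finset (Fin N → ℕ)} (hAB : ∀ a ∈ A, ∀ b ∈ B, MeetsAt a b)
    (hA : ∀ x, ∀ a ∈ A, lower x a ∈ A) {a b : Fin N → ℕ} (ha : a ∈ A) (hb : b ∈ B) :
    ∃ i, a i = 1 ∧ b i = 1 := by
  induction hn : ∑ i, a i using Nat.strong_induction_on generalizing a with
  | _ n ih =>
    obtain ⟨i, h1, h2⟩ := hAB a ha b hb
    by_cases hi : a i = 1
    · exact ⟨i, hi, h1 ▸ hi⟩
    · have hl : lower (i, a i) a = Function.update a i 1 := if_pos ⟨by simp only; omega, rfl⟩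
      have hne : lower (i, a i) a ≠ a := by
        intro h
        have := congrFun h i
        rw [hl] at this
        simp only [Function.update_self] at this
        exact hi this.symm
      obtain ⟨j, h3, h4⟩ := ih _ (hn ▸ sum_lower_lt _ _ hne) (hA (i, a i) a ha) rfl
      refine ⟨j, ?_, h4⟩
      by_cases hj : j = i
      · subst hj
        omega
      · rwa [lower_apply_of_ne _ _ hj] at h3

/-- The bound for `A` and `B`, with the case of equality. -/
def SeqBound [NeZero N] (c d : Fin N → ℕ) (r s : ℕ) (A B : Finset (Fin N → ℕ)) : Prop :=
  A.card * B.card ≤ (star c r 0 1).card * (star d s 0 1).card ∧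
    (A.card * B.card = (star c r 0 1).card * (star d s 0 1).card →
      ∃ p q, 1 ≤ q ∧ A = star c r p q ∧ B = star d s p q)

theorem eq_and_eq_of_mul_eq_mul {a b a' b' : ℕ} (ha : a ≤ a') (hb : b ≤ b') (ha' : 0 < a')
    (hb' : 0 < b') (h : a * b = a' * b') : a = a' ∧ b = b' := by
  constructor
  · by_contra hne
    have h1 : a < a' := lt_of_le_of_ne ha hne
    have : a * b < a' * b' := Nat.mul_lt_mul_of_lt_of_le h1 hb hb'
    omega
  · by_contra hne
    have h1 : b < b' := lt_of_le_of_ne hb hne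
    have : a * b < a' * b' := Nat.mul_lt_mul_of_le_of_lt ha h1 ha'
    omega

theorem card_star_pos [NeZero N] {c : Fin N → ℕ} {r : ℕ} (h : 0 < weight c r {0}) :
    0 < (star c r 0 1).card := by
  refine lt_of_lt_of_le h (Finset.card_le_card fun a ha => ?_)
  rw [Finset.mem_filter] at ha
  rw [mem_star, ← mem_ones, ha.2]
  exact ⟨ha.1, Finset.mem_singleton_self 0⟩

theorem seqBound_of_stable [NeZero N] {c d : Fin N → ℕ} (hc : Capped c) (hd : Capped d) {r s : ℕ}
    (hr : 0 < weight c r {0}) (hs : 0 < weight d s {0}) {A B : Finset (Fin N → ℕ)}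
    (hA : A ⊆ S c r) (hB : B ⊆ S d s) (hAB : ∀ a ∈ A, ∀ b ∈ B, MeetsAt a b)
    (hstable : ∀ x, ∀ a ∈ A, lower x a ∈ A) : SeqBound c d r s A B := by
  have hcross : CrossInt (A.image ones) (B.image ones) := by
    intro X hX Y hY
    obtain ⟨a, ha, rfl⟩ := Finset.mem_image.mp hX
    obtain ⟨b, hb, rfl⟩ := Finset.mem_image.mp hY
    obtain ⟨i, h1, h2⟩ := exists_one_of_stable hAB hstable ha hb
    rw [Finset.not_disjoint_iff]
    exact ⟨i, mem_ones.mpr h1, mem_ones.mpr h2⟩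
  obtain ⟨h1, h2⟩ := starBound_of_crossInt (Finset.mem_univ 0) (fun x _ => Fin.zero_le x)
    (hc.isWeight r) (hd.isWeight s) (s := A.image ones) (t := B.image ones)
    (by simp) (by simp) hcross
  rw [sum_setStar_weight, sum_setStar_weight] at h1 h2
  have hle : (A.card : ℝ) * B.card ≤ (∑ X ∈ A.image ones, (weight c r X : ℝ)) *
      ∑ X ∈ B.image ones, (weight d s X : ℝ) :=
    mul_le_mul (card_le_sum_weight hA) (card_le_sum_weight hB) (Nat.cast_nonneg _)
      (Finset.sum_nonneg fun _ _ => Nat.cast_nonneg _)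
  refine ⟨by exact_mod_cast hle.trans h1, fun heq => ?_⟩
  have heq' : (A.card : ℝ) * B.card = (star c r 0 1).card * (star d s 0 1).card := by
    exact_mod_cast heq
  -- The singleton `{p}` occurs in both images, so by cross-intersection every member of either
  -- family has a 1 in position `p`.
  obtain ⟨p, hpA, hpB⟩ := h2 (Nat.cast_pos.mpr hr) (Nat.cast_pos.mpr hs)
    (le_antisymm h1 (heq' ▸ hle))
  have key : ∀ {u t : Finset (Finset (Fin N))}, CrossInt u t → {p} ∈ u → ∀ Y ∈ t, p ∈ Y := by
    intro u t h hp Y hY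
    simpa using h _ hp _ hY
  have hA' : A ⊆ star c r p 1 := fun a ha => mem_star.mpr
    ⟨hA ha, mem_ones.mp (key hcross.symm hpB _ (Finset.mem_image_of_mem _ ha))⟩
  have hB' : B ⊆ star d s p 1 := fun b hb => mem_star.mpr
    ⟨hB hb, mem_ones.mp (key hcross hpA _ (Finset.mem_image_of_mem _ hb))⟩
  have hcA := hc.card_star_le_zero r p le_rfl
  have hcB := hd.card_star_le_zero s p le_rfl
  obtain ⟨h3, h4⟩ := eq_and_eq_of_mul_eq_mul ((Finset.card_le_card hA').trans hcA)
    ((Finset.card_le_card hB').trans hcB) (card_star_pos hr) (card_star_pos hs) heq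
  exact ⟨p, 1, le_rfl, Finset.eq_of_subset_of_card_le hA' (by omega),
    Finset.eq_of_subset_of_card_le hB' (by omega)⟩

theorem subset_star_of_compr_lower {c : Fin N → ℕ} {r : ℕ} {x : Fin N × ℕ} {p : Fin N} {q : ℕ}
    {A : Finset (Fin N → ℕ)} (hA : A ⊆ S c r) (h : compr (lower x) A = star c r p q)
    (hx : x.1 ≠ p ∨ q ≠ 1) : A ⊆ star c r p q := by
  intro a ha
  by_cases hl : lower x a ∈ A
  · rw [← h]
    exact mem_compr.mpr (Or.inl ⟨ha, hl⟩)
  · have h1 : lower x a ∈ star c r p q := by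
      rw [← h]
      exact mem_compr.mpr (Or.inr ⟨a, ha, hl, rfl⟩)
    have h2 := (lower_ne (x := x) (a := a) fun h => hl (h.symm ▸ ha)).2
    have h3 := (mem_star.mp h1).2
    refine mem_star.mpr ⟨hA ha, ?_⟩
    by_cases hp : x.1 = p
    · subst hp
      rw [h2, Function.update_self] at h3
      exact absurd h3.symm (hx.resolve_left (by simp))
    · rwa [lower_apply_of_ne x a (Ne.symm hp)] at h3

/-- There is a sequence with a `1` in position `p` that meets neither `b` nor `b'` elsewhere. -/
theorem Capped.exists_avoiding {c : Fin N → ℕ} (hc : Capped c) {r : ℕ} {p : Fin N}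
    {a : Fin N → ℕ} (ha : a ∈ star c r p 1) (b b' : Fin N → ℕ) :
    ∃ a' ∈ star c r p 1, ∀ i, i ≠ p → a' i ≠ 0 → a' i ≠ b i ∧ a' i ≠ b' i := by
  have havoid : ∀ i, ∃ v, 1 ≤ v ∧ v ≤ 3 ∧ v ≠ b i ∧ v ≠ b' i := by
    intro i
    by_contra! h
    have h1 := h 1
    have h2 := h 2
    have h3 := h 3
    omega
  choose v hv1 hv2 hv3 hv4 using havoid
  rw [mem_star, mem_S] at ha
  refine ⟨fun i => if i = p then 1 else if a i = 0 then 0 else v i, ?_, ?_⟩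
  · rw [mem_star, mem_S]
    refine ⟨⟨fun i => ?_, ?_⟩, by simp⟩
    · have := ha.1.1 i
      have := hc i i le_rfl
      have := hv2 i
      split_ifs with h h'
      · subst h
        omega
      · omega
      · omega
    · rw [← ha.1.2]
      congr 1
      ext i
      rw [mem_supp, mem_supp]
      have := hv1 i
      split_ifs with h h'
      · subst h
        omega
      · omega
      · omega
  · intro i hi h
    simp only [if_neg hi] at h ⊢
    split_ifs at h ⊢ with h'
    · exact absurd rfl h
    · exact ⟨hv3 i, hv4 i⟩

theorem exists_mem_of_mem_compr_lower {x : Fin N × ℕ} {A : Finset (Fin N → ℕ)} {a : Fin N → ℕ}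
    (ha : a ∈ compr (lower x) A) : ∃ a' ∈ A, ∀ i, i ≠ x.1 → a' i = a i := by
  rcases mem_compr.mp ha with h | ⟨b, hb, -, rfl⟩
  · exact ⟨a, h.1, fun _ _ => rfl⟩
  · exact ⟨b, hb, fun i hi => (lower_apply_of_ne x b hi).symm⟩

/-- The only case in which lowering could create the star is lowering to 1 in its own position.
There the original entries must be shown to be constant across both families. -/
theorem exists_star_of_compr_lower {c d : Fin N → ℕ} (hc : Capped c) (hd : Capped d) {r s : ℕ}
    {A B : Finset (Fin N → ℕ)} (hA : A ⊆ S c r) (hB : B ⊆ S d s)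
    (hAB : ∀ a ∈ A, ∀ b ∈ B, MeetsAt a b) (hA0 : A.Nonempty) (hB0 : B.Nonempty) (x : Fin N × ℕ)
    (h : ∃ p q, 1 ≤ q ∧ compr (lower x) A = star c r p q ∧ compr (lower x) B = star d s p q) :
    ∃ p q, 1 ≤ q ∧ A = star c r p q ∧ B = star d s p q := by
  obtain ⟨p, q, hq, hcA, hcB⟩ := h
  have hcardA := card_compr (lower_inj x) A
  have hcardB := card_compr (lower_inj x) B
  by_cases hx : x.1 ≠ p ∨ q ≠ 1
  · refine ⟨p, q, hq, Finset.eq_of_subset_of_card_le (subset_star_of_compr_lower hA hcA hx) ?_,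
      Finset.eq_of_subset_of_card_le (subset_star_of_compr_lower hB hcB hx) ?_⟩
    · rw [← hcA, hcardA]
    · rw [← hcB, hcardB]
  push Not at hx
  obtain ⟨rfl, rfl⟩ := hx
  obtain ⟨a₀, ha₀⟩ := hA0
  obtain ⟨b₀, hb₀⟩ := hB0
  have hstarA : (star c r x.1 1).Nonempty := by
    rw [← hcA, ← Finset.card_pos, hcardA]
    exact Finset.card_pos.mpr ⟨a₀, ha₀⟩
  have hstarB : (star d s x.1 1).Nonempty := by
    rw [← hcB, ← Finset.card_pos, hcardB]
    exact Finset.card_pos.mpr ⟨b₀, hb₀⟩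
  obtain ⟨a₁, ha₁⟩ := hstarA
  obtain ⟨b₁, hb₁⟩ := hstarB
  -- Lowering leaves all other positions unchanged, so `B` has a member `b₃` avoiding `a` off `x.1`,
  -- and `A` has a member `a₃` avoiding both `b` and `b₃` there. The pairs `a, b₃`, then `a₃, b₃`,
  -- then `a₃, b` can meet only at `x.1`, which links the entry of `a` to that of `b`.
  have key : ∀ a ∈ A, ∀ b ∈ B, a x.1 = b x.1 ∧ a x.1 ≠ 0 := by
    intro a ha b hb
    obtain ⟨b₂, hb₂, hb₂'⟩ := hd.exists_avoiding hb₁ a a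
    rw [← hcB] at hb₂
    obtain ⟨b₃, hb₃, hb₃'⟩ := exists_mem_of_mem_compr_lower hb₂
    obtain ⟨a₂, ha₂, ha₂'⟩ := hc.exists_avoiding ha₁ b b₃
    rw [← hcA] at ha₂
    obtain ⟨a₃, ha₃, ha₃'⟩ := exists_mem_of_mem_compr_lower ha₂
    have e1 : a x.1 = b₃ x.1 ∧ a x.1 ≠ 0 := by
      obtain ⟨i, h1, h2⟩ := hAB a ha b₃ hb₃
      by_cases hi : i = x.1
      · exact hi ▸ ⟨h1, h2⟩
      · have := hb₃' i hi
        exact absurd (by omega) (hb₂' i hi (by omega)).1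
    have e2 : a₃ x.1 = b₃ x.1 := by
      obtain ⟨i, h1, h2⟩ := hAB a₃ ha₃ b₃ hb₃
      by_cases hi : i = x.1
      · exact hi ▸ h1
      · have := ha₃' i hi
        exact absurd (by omega) (ha₂' i hi (by omega)).2
    have e3 : a₃ x.1 = b x.1 := by
      obtain ⟨i, h1, h2⟩ := hAB a₃ ha₃ b hb
      by_cases hi : i = x.1
      · exact hi ▸ h1
      · have := ha₃' i hi
        exact absurd (by omega) (ha₂' i hi (by omega)).1
    omega
  have hq := key a₀ ha₀ b₀ hb₀
  have hcard : ∀ {c : Fin N → ℕ} {r : ℕ} {b : Fin N → ℕ}, b ∈ star c r x.1 1 →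
      (star c r x.1 (a₀ x.1)).card ≤ (star c r x.1 1).card := by
    intro c r b hb
    rw [mem_star, mem_S] at hb
    have := hb.1.1 x.1
    exact card_star_le le_rfl (by omega) le_rfl (by omega)
  refine ⟨x.1, a₀ x.1, by omega, Finset.eq_of_subset_of_card_le ?_ ?_,
    Finset.eq_of_subset_of_card_le ?_ ?_⟩
  · intro a ha
    have := key a ha b₀ hb₀
    exact mem_star.mpr ⟨hA ha, by omega⟩
  · rw [← hcardA, hcA]
    exact hcard ha₁
  · intro b hb
    have := key a₀ ha₀ b hb
    exact mem_star.mpr ⟨hB hb, by omega⟩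
  · rw [← hcardB, hcB]
    exact hcard hb₁

/-- The theorem for two cross-intersecting families of sequences of the same length. -/
theorem seqBound_of_cross [NeZero N] {c d : Fin N → ℕ} (hc : Capped c) (hd : Capped d) {r s : ℕ}
    (hr : 0 < weight c r {0}) (hs : 0 < weight d s {0}) (A B : Finset (Fin N → ℕ))
    (hAB : ∀ a ∈ A, ∀ b ∈ B, MeetsAt a b) : A ⊆ S c r → B ⊆ S d s → SeqBound c d r s A B := by
  refine compr_induction (f := lower) (R := MeetsAt) (fun a => ∑ i, a i) lower_inj sum_lower_lt
    (fun _ _ h => h.symm) (fun x _ _ h => h.lower x) MeetsAt.lower_left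
    (P := fun A B => A ⊆ S c r → B ⊆ S d s → SeqBound c d r s A B) ?_ ?_ A B hAB
  · intro A B hAB hstA _ hA hB
    exact seqBound_of_stable hc hd hr hs hA hB hAB hstA
  · intro x A B hAB hP hA hB
    obtain ⟨h1, h2⟩ := hP (compr_lower_subset x hA) (compr_lower_subset x hB)
    rw [card_compr (lower_inj x), card_compr (lower_inj x)] at h1 h2
    refine ⟨h1, fun heq => exists_star_of_compr_lower hc hd hA hB hAB ?_ ?_ x (h2 heq)⟩
    all_goals
      have hpos : 0 < A.card * B.card := heq ▸ Nat.mul_pos (card_star_pos hr) (card_star_pos hs)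
    · exact Finset.card_pos.mp (Nat.pos_of_mul_pos_right hpos)
    · exact Finset.card_pos.mp (Nat.pos_of_mul_pos_left hpos)

end Sequences

/-! ### Padding with zeros to a common length. -/

section Padding

variable {n N : ℕ}

/-- Extend a sequence by zeros to length `N`. -/
def pad (N : ℕ) (a : Fin n → ℕ) : Fin N → ℕ :=
  fun i => if h : (i : ℕ) < n then a ⟨i, h⟩ else 0

theorem pad_castLE (h : n ≤ N) (a : Fin n → ℕ) (i : Fin n) : pad N a (Fin.castLE h i) = a i := by
  simp [pad]

theorem pad_of_le (a : Fin n → ℕ) {i : Fin N} (h : n ≤ (i : ℕ)) : pad N a i = 0 := by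
  simp [pad, not_lt.mpr h]

theorem pad_injective (h : n ≤ N) : Function.Injective (pad N : (Fin n → ℕ) → Fin N → ℕ) := by
  intro a b hab
  funext i
  rw [← pad_castLE h a, hab, pad_castLE]

theorem exists_castLE_eq (h : n ≤ N) {i : Fin N} (hi : (i : ℕ) < n) :
    ∃ j : Fin n, Fin.castLE h j = i :=
  ⟨⟨i, hi⟩, rfl⟩

theorem card_supp_pad (h : n ≤ N) (a : Fin n → ℕ) : (supp (pad N a)).card = (supp a).card := by
  rw [← Finset.card_map (Fin.castLEEmb h)]
  congr 1
  ext i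
  simp only [Finset.mem_map, mem_supp, Fin.castLEEmb_apply]
  constructor
  · intro hi
    by_cases hin : (i : ℕ) < n
    · obtain ⟨j, rfl⟩ := exists_castLE_eq h hin
      rw [pad_castLE] at hi
      exact ⟨j, hi, rfl⟩
    · exact absurd (pad_of_le a (not_lt.mp hin)) hi
  · rintro ⟨j, hj, rfl⟩
    rwa [pad_castLE]

theorem pad_mem_S (h : n ≤ N) {c a : Fin n → ℕ} {r : ℕ} : pad N a ∈ S (pad N c) r ↔ a ∈ S c r := by
  rw [mem_S, mem_S, card_supp_pad h]
  refine and_congr_left fun _ => ⟨fun ha i => ?_, fun ha i => ?_⟩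
  · have := ha (Fin.castLE h i)
    rwa [pad_castLE, pad_castLE] at this
  · by_cases hin : (i : ℕ) < n
    · obtain ⟨j, rfl⟩ := exists_castLE_eq h hin
      rw [pad_castLE, pad_castLE]
      exact ha j
    · rw [pad_of_le a (not_lt.mp hin)]
      exact Nat.zero_le _

theorem pad_mem_star (h : n ≤ N) {c a : Fin n → ℕ} {r : ℕ} {p : Fin n} {q : ℕ} :
    pad N a ∈ star (pad N c) r (Fin.castLE h p) q ↔ a ∈ star c r p q := by
  rw [mem_star, mem_star, pad_mem_S h, pad_castLE]

theorem exists_pad_eq (h : n ≤ N) {c : Fin n → ℕ} {r : ℕ} {b : Fin N → ℕ}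
    (hb : b ∈ S (pad N c) r) : ∃ a : Fin n → ℕ, pad N a = b := by
  refine ⟨fun i => b (Fin.castLE h i), ?_⟩
  funext i
  by_cases hin : (i : ℕ) < n
  · obtain ⟨j, rfl⟩ := exists_castLE_eq h hin
    rw [pad_castLE]
  · have := (mem_S.mp hb).1 i
    rw [pad_of_le _ (not_lt.mp hin)] at this ⊢
    omega

theorem image_pad_star (h : n ≤ N) (c : Fin n → ℕ) (r : ℕ) (p : Fin n) (q : ℕ) :
    (star c r p q).image (pad N) = star (pad N c) r (Fin.castLE h p) q := by
  ext b
  rw [Finset.mem_image]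
  constructor
  · rintro ⟨a, ha, rfl⟩
    exact (pad_mem_star h).mpr ha
  · intro hb
    obtain ⟨a, rfl⟩ := exists_pad_eq h (mem_star.mp hb).1
    exact ⟨a, (pad_mem_star h).mp hb, rfl⟩

theorem image_pad_subset (h : n ≤ N) {c : Fin n → ℕ} {r : ℕ} {A : Finset (Fin n → ℕ)}
    (hA : A ⊆ S c r) : A.image (pad N) ⊆ S (pad N c) r := by
  intro b hb
  obtain ⟨a, ha, rfl⟩ := Finset.mem_image.mp hb
  exact (pad_mem_S h).mpr (hA ha)

theorem IsIP.capped_pad [NeZero n] (h : n ≤ N) {c : Fin n → ℕ} (hc : IsIP c) (h3 : 3 ≤ c 0) :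
    Capped (pad N c) := by
  intro i j hij hj
  have hjn : (j : ℕ) < n := by
    by_contra hjn
    exact hj (pad_of_le c (not_lt.mp hjn))
  have hin : (i : ℕ) < n := lt_of_le_of_lt hij hjn
  obtain ⟨i, rfl⟩ := exists_castLE_eq h hin
  obtain ⟨j, rfl⟩ := exists_castLE_eq h hjn
  rw [pad_castLE, pad_castLE]
  exact ⟨h3.trans (hc.1 (Fin.zero_le i)), hc.1 hij⟩

theorem weight_pad_pos [NeZero n] [NeZero N] (h : n ≤ N) {c : Fin n → ℕ} (hc : IsIP c)
    (h3 : 3 ≤ c 0) {r : ℕ} (hr1 : 1 ≤ r) (hrn : r ≤ n) : 0 < weight (pad N c) r {0} := by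
  refine weight_singleton_pos hr1 (hrn.trans h) fun i hi => ?_
  obtain ⟨j, rfl⟩ := exists_castLE_eq h (lt_of_lt_of_le hi hrn)
  rw [pad_castLE]
  exact h3.trans (hc.1 (Fin.zero_le j))

theorem card_star_pad [NeZero n] [NeZero N] (h : n ≤ N) (c : Fin n → ℕ) (r : ℕ) :
    (star (pad N c) r 0 1).card = (star c r 0 1).card := by
  have : (0 : Fin N) = Fin.castLE h 0 := by
    ext
    simp
  rw [this, ← image_pad_star h, Finset.card_image_of_injective _ (pad_injective h)]

theorem lt_of_star_pad_nonempty {c : Fin n → ℕ} {r : ℕ} {p : Fin N} {q : ℕ} (hq : 1 ≤ q)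
    (h : (star (pad N c) r p q).Nonempty) : (p : ℕ) < n := by
  obtain ⟨a, ha⟩ := h
  rw [mem_star, mem_S] at ha
  by_contra hp
  have := ha.1.1 p
  rw [pad_of_le c (not_lt.mp hp)] at this
  omega

end Padding

/-! ### Pairs of families of different lengths, and sizes of stars. -/

theorem card_star_zero_pos {n : ℕ} [NeZero n] {c : Fin n → ℕ} (hc : IsIP c) {r : ℕ}
    (hr1 : 1 ≤ r) (hrn : r ≤ n) : 0 < (star c r 0 1).card := by
  obtain ⟨I, hI, hIr⟩ := Finset.exists_superset_card_eq (s := {(0 : Fin n)}) (n := r)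
    (by simpa using hr1) (by simpa using hrn)
  have h0 : (0 : Fin n) ∈ I := hI (Finset.mem_singleton_self _)
  refine Finset.card_pos.mpr ⟨fun i => if i ∈ I then 1 else 0, ?_⟩
  rw [mem_star, mem_S]
  refine ⟨⟨fun i => ?_, ?_⟩, if_pos h0⟩
  · have := hc.2 i
    split_ifs <;> omega
  · rw [← hIr]
    congr 1
    ext i
    simp [mem_supp]

/-- The theorem for two cross-intersecting families. -/
theorem card_mul_card_le {n m : ℕ} [NeZero n] [NeZero m] {c : Fin n → ℕ} {d : Fin m → ℕ}
    (hc : IsIP c) (hd : IsIP d) (hc3 : 3 ≤ c 0) (hd3 : 3 ≤ d 0) {r s : ℕ}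
    (hr : 1 ≤ r ∧ r ≤ n) (hs : 1 ≤ s ∧ s ≤ m) {A : Finset (Fin n → ℕ)} {B : Finset (Fin m → ℕ)}
    (hA : A ⊆ S c r) (hB : B ⊆ S d s) (hAB : ∀ a ∈ A, ∀ b ∈ B, Meets a b) :
    A.card * B.card ≤ (star c r 0 1).card * (star d s 0 1).card ∧
      (A.card * B.card = (star c r 0 1).card * (star d s 0 1).card →
        ∃ (p : ℕ) (hp : p < n) (hp' : p < m) (q : ℕ), 1 ≤ q ∧ A = star c r ⟨p, hp⟩ q ∧
          B = star d s ⟨p, hp'⟩ q) := by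
  have hn := le_max_left n m
  have hm := le_max_right n m
  have : NeZero (max n m) := ⟨by have := NeZero.ne n; omega⟩
  obtain ⟨h1, h2⟩ := seqBound_of_cross (hc.capped_pad hn hc3) (hd.capped_pad hm hd3)
    (weight_pad_pos hn hc hc3 hr.1 hr.2) (weight_pad_pos hm hd hd3 hs.1 hs.2)
    (A.image (pad _)) (B.image (pad _)) (by
      intro a' ha' b' hb'
      obtain ⟨a, ha, rfl⟩ := Finset.mem_image.mp ha'
      obtain ⟨b, hb, rfl⟩ := Finset.mem_image.mp hb'
      obtain ⟨i, hin, him, h1, h2⟩ := hAB a ha b hb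
      refine ⟨⟨i, by omega⟩, ?_⟩
      simpa [pad, hin, him] using And.intro h1 h2)
    (image_pad_subset hn hA) (image_pad_subset hm hB)
  rw [card_star_pad hn, card_star_pad hm, Finset.card_image_of_injective _ (pad_injective hn),
    Finset.card_image_of_injective _ (pad_injective hm)] at h1 h2
  refine ⟨h1, fun heq => ?_⟩
  obtain ⟨p, q, hq, hA', hB'⟩ := h2 heq
  have hpos : 0 < A.card * B.card :=
    heq ▸ Nat.mul_pos (card_star_zero_pos hc hr.1 hr.2) (card_star_zero_pos hd hs.1 hs.2)
  have hpn := lt_of_star_pad_nonempty hq (hA' ▸ (Finset.image_nonempty.mpr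
    (Finset.card_pos.mp (Nat.pos_of_mul_pos_right hpos))))
  have hpm := lt_of_star_pad_nonempty hq (hB' ▸ (Finset.image_nonempty.mpr
    (Finset.card_pos.mp (Nat.pos_of_mul_pos_left hpos))))
  refine ⟨p, hpn, hpm, q, hq, ?_, ?_⟩
  · apply Finset.image_injective (pad_injective hn)
    rw [hA', image_pad_star hn]
    rfl
  · apply Finset.image_injective (pad_injective hm)
    rw [hB', image_pad_star hm]
    rfl

/-- The star is split by the support outside the first position; once this support is fixed, its
entries are chosen freely. -/
theorem card_star_zero_eq_bound {n : ℕ} [NeZero n] {c : Fin n → ℕ} (hc : IsIP c) {r : ℕ}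
    (hr : 1 ≤ r) : (star c r 0 1).card = bound c r := by
  rw [bound, Finset.card_eq_sum_card_fiberwise (f := fun a => (supp a).erase 0)
    (t := ((Finset.univ : Finset (Fin n)).erase 0).powersetCard (r - 1))]
  · refine Finset.sum_congr rfl fun I hI => ?_
    rw [Finset.mem_powersetCard] at hI
    have h0 : (0 : Fin n) ∉ I := fun h => Finset.notMem_erase _ _ (hI.1 h)
    have : ((star c r 0 1).filter fun a => (supp a).erase 0 = I) =
        Fintype.piFinset fun j => if j = 0 then {1} else if j ∈ I then Finset.Icc 1 (c j)
          else {0} := by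
      ext a
      rw [Finset.mem_filter, mem_star, mem_S, Fintype.mem_piFinset]
      constructor
      · rintro ⟨⟨⟨h1, h2⟩, h3⟩, rfl⟩ j
        split_ifs with hj hj'
        · rw [hj, h3]
          exact Finset.mem_singleton_self _
        · rw [Finset.mem_erase, mem_supp] at hj'
          exact Finset.mem_Icc.mpr ⟨by omega, h1 j⟩
        · rw [Finset.mem_erase, mem_supp] at hj'
          rw [Finset.mem_singleton]
          by_contra h
          exact hj' ⟨hj, h⟩
      · intro h
        have ha0 : a 0 = 1 := by simpa using h 0
        have hsupp : (supp a).erase 0 = I := by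
          ext j
          rw [Finset.mem_erase, mem_supp]
          by_cases hj : j = 0
          · subst hj
            simp [h0]
          · have := h j
            rw [if_neg hj] at this
            split_ifs at this with hjI
            · rw [Finset.mem_Icc] at this
              simp only [hj, hjI, ne_eq, not_false_eq_true, true_and, iff_true]
              omega
            · rw [Finset.mem_singleton] at this
              simp [this, hjI]
        refine ⟨⟨⟨fun j => ?_, ?_⟩, ha0⟩, hsupp⟩
        · have := h j
          have := hc.2 j
          by_cases hj : j = 0
          · subst hj
            omega
          · rw [if_neg hj] at *
            split_ifs at * <;> simp only [Finset.mem_Icc, Finset.mem_singleton] at * <;> omega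
        · have hmem : (0 : Fin n) ∈ supp a := by
            rw [mem_supp, ha0]
            exact one_ne_zero
          have := Finset.card_erase_add_one hmem
          rw [hsupp, hI.2] at this
          omega
    rw [this, Fintype.card_piFinset]
    rw [← Finset.prod_subset (Finset.subset_univ I)]
    · refine Finset.prod_congr rfl fun j hj => ?_
      rw [if_neg fun h : j = 0 => h0 (h ▸ hj), if_pos hj]
      simp
    · intro j _ hj
      rw [if_neg hj]
      split_ifs <;> simp
  · intro a ha
    simp only [Finset.mem_coe, mem_star, mem_S] at ha
    simp only [Finset.mem_coe, Finset.mem_powersetCard]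
    refine ⟨Finset.erase_subset_erase _ (Finset.subset_univ _), ?_⟩
    rw [Finset.card_erase_of_mem (mem_supp.mpr (by omega)), ha.1.2]

/-- The injection behind `card_star_le` only produces entries at most `c p'` in position `p`. It
misses a sequence with entry `c p` there, which exists because `2 ≤ r` leaves room for both `p` and
`p'` in the support. -/
theorem card_star_lt {n : ℕ} {c : Fin n → ℕ} (hc : IsIP c) {r : ℕ} (hr2 : 2 ≤ r) (hrn : r ≤ n)
    {p p' : Fin n} {q q' : ℕ} (hpp : c p' < c p) (hq : 1 ≤ q) (hq' : 1 ≤ q') (hqc : q' ≤ c p') :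
    (star c r p q).card < (star c r p' q').card := by
  have hne : p ≠ p' := by
    rintro rfl
    exact hpp.false
  rw [← Finset.card_image_of_injOn (swap_update_injOn (c := c) (r := r) (p := p) (p' := p')
    (q := q) (q' := q'))]
  refine Finset.card_lt_card ?_
  rw [Finset.ssubset_iff_of_subset]
  · obtain ⟨I, hI, hIr⟩ := Finset.exists_superset_card_eq (s := {p, p'}) (n := r)
      (by rw [Finset.card_pair hne]; exact hr2) (by simpa using hrn)
    have hpI : p ∈ I := hI (by simp)
    have hpI' : p' ∈ I := hI (by simp)
    refine ⟨fun i => if i = p' then q' else if i ∈ I then c i else 0, ?_, ?_⟩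
    · rw [mem_star, mem_S]
      refine ⟨⟨fun i => ?_, ?_⟩, by simp⟩
      · split_ifs with h h'
        · exact h ▸ hqc
        · exact le_rfl
        · exact Nat.zero_le _
      · rw [← hIr]
        congr 1
        ext i
        rw [mem_supp]
        have := hc.2 i
        split_ifs with h h'
        · subst h
          simp only [hpI', iff_true]
          omega
        · simp only [h', iff_true]
          omega
        · simp [h']
    · rw [Finset.mem_image]
      rintro ⟨a, ha, h⟩
      have h1 := congrFun h p
      simp only [Function.update_of_ne hne, Function.comp_apply, Equiv.swap_apply_left,
        if_neg hne, if_pos hpI] at h1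
      have := (mem_S.mp (mem_star.mp ha).1).1 p'
      omega
  · intro b hb
    obtain ⟨a, ha, rfl⟩ := Finset.mem_image.mp hb
    exact swap_update_mem_star hpp.le hq hq' hqc ha

theorem card_star_one {n : ℕ} {c : Fin n → ℕ} {p : Fin n} {q : ℕ} (hq : 1 ≤ q) (hqc : q ≤ c p) :
    (star c 1 p q).card = 1 := by
  rw [Finset.card_eq_one]
  refine ⟨Function.update 0 p q, ?_⟩
  ext a
  rw [mem_star, mem_S, Finset.mem_singleton]
  constructor
  · rintro ⟨⟨-, h2⟩, h3⟩
    obtain ⟨i, hi⟩ := Finset.card_eq_one.mp h2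
    have hpi : p = i := by
      rw [← Finset.mem_singleton, ← hi, mem_supp]
      omega
    funext j
    by_cases hj : j = p
    · subst hj
      simpa using h3
    · rw [Function.update_of_ne hj, Pi.zero_apply]
      by_contra h
      rw [← ne_eq, ← mem_supp, hi, Finset.mem_singleton] at h
      exact hj (h.trans hpi.symm)
  · rintro rfl
    refine ⟨⟨fun j => ?_, ?_⟩, by simp⟩
    · by_cases hj : j = p
      · subst hj
        simpa using hqc
      · simp [hj]
    · rw [Finset.card_eq_one]
      refine ⟨p, ?_⟩
      ext j
      rw [mem_supp, Finset.mem_singleton]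
      by_cases hj : j = p
      · subst hj
        simp
        omega
      · simp [hj]

theorem card_star_eq {n : ℕ} [NeZero n] {c : Fin n → ℕ} (hc : IsIP c) {r : ℕ} {p : Fin n} {q : ℕ}
    (hp : c p = c 0 ∨ r = 1) (hq : 1 ≤ q) (hqc : q ≤ c p) :
    (star c r p q).card = (star c r 0 1).card := by
  rcases hp with hp | rfl
  · exact le_antisymm (card_star_le hp.ge hq le_rfl (hc.2 0))
      (card_star_le hp.le le_rfl hq hqc)
  · rw [card_star_one hq hqc, card_star_one le_rfl (hc.2 0)]

/-- With different positions, a member could be changed in `p'` to a nonzero value other than `q'`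
without leaving the first star. -/
theorem star_injective {n : ℕ} {c : Fin n → ℕ} (h3 : ∀ i, 3 ≤ c i) {r : ℕ} {p p' : Fin n}
    {q q' : ℕ} (hq' : 1 ≤ q') (hne : (star c r p q).Nonempty)
    (h : star c r p q = star c r p' q') : p = p' ∧ q = q' := by
  obtain ⟨a, ha⟩ := hne
  have ha1 := mem_star.mp ha
  have ha2 := mem_star.mp (h ▸ ha)
  have hp : p = p' := by
    by_contra hp
    obtain ⟨v, hv0, hv, hvc⟩ : ∃ v, v ≠ 0 ∧ v ≠ q' ∧ v ≤ c p' := by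
      have := h3 p'
      by_cases h1 : q' = 1
      · exact ⟨2, by omega, by omega, by omega⟩
      · exact ⟨1, by omega, by omega, by omega⟩
    have h1 : Function.update a p' v ∈ star c r p q := by
      rw [mem_star, Function.update_of_ne hp]
      exact ⟨update_mem_S ha1.1 (by omega) hv0 hvc, ha1.2⟩
    rw [h, mem_star, Function.update_self] at h1
    exact hv h1.2
  subst hp
  exact ⟨rfl, ha1.2.symm.trans ha2.2⟩

/-! ### Sequences without zeros and with first bound 1 or 2. -/

section FullSupport

variable {n : ℕ}

theorem ne_zero_of_mem_S {c a : Fin n → ℕ} (ha : a ∈ S c n) (i : Fin n) : a i ≠ 0 := by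
  have h := (mem_S.mp ha).2
  have : supp a = Finset.univ := by
    rw [← Finset.card_eq_iff_eq_univ, h, Fintype.card_fin]
  rw [← mem_supp, this]
  exact Finset.mem_univ i

theorem mem_S_of_ne_zero {c a : Fin n → ℕ} (ha : ∀ i, a i ≠ 0) (hac : ∀ i, a i ≤ c i) :
    a ∈ S c n := by
  refine mem_S.mpr ⟨hac, ?_⟩
  have : supp a = Finset.univ := by
    ext i
    simp [mem_supp, ha]
  rw [this, Finset.card_univ, Fintype.card_fin]

theorem S_eq_star_of_zero_eq_one [NeZero n] {c : Fin n → ℕ} (h : c 0 = 1) : S c n = star c n 0 1 := by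
  ext a
  rw [mem_star]
  refine ⟨fun ha => ⟨ha, ?_⟩, fun ha => ha.1⟩
  have h1 := ne_zero_of_mem_S ha 0
  have h2 := (mem_S.mp ha).1 0
  omega

theorem card_mul_card_le_of_zero_eq_two [NeZero n] {c : Fin n → ℕ} (hc : IsIP c) (h2 : c 0 = 2)
    {A B : Finset (Fin n → ℕ)} (hA : A ⊆ S c n) (hB : B ⊆ S c n)
    (hAB : ∀ a ∈ A, ∀ b ∈ B, Meets a b) :
    A.card * B.card ≤ (star c n 0 1).card * (star c n 0 1).card := by
  have hc2 : ∀ i, 2 ≤ c i := fun i => h2 ▸ hc.1 (Fin.zero_le i)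
  -- All values are rotated cyclically. As every bound is at least 2, `σ a` agrees with `a` nowhere,
  -- so `σ` maps `A` injectively off `B`. Thus the two sizes add up to at most twice that of the
  -- star, and the product bound is the inequality of the means.
  let σ : (Fin n → ℕ) → Fin n → ℕ := fun a i => if a i = c i then 1 else a i + 1
  have hinj : Set.InjOn σ (A : Set (Fin n → ℕ)) := by
    intro a ha b hb hab
    funext i
    have h1 := ne_zero_of_mem_S (hA ha) i
    have h2 := ne_zero_of_mem_S (hA hb) i
    have h3 : (if a i = c i then 1 else a i + 1) = if b i = c i then 1 else b i + 1 :=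
      congrFun hab i
    split_ifs at h3 <;> omega
  have hσ : ∀ a ∈ A, σ a ∈ S c n := by
    intro a ha
    refine mem_S_of_ne_zero (fun i => ?_) fun i => ?_
    · simp only [σ]
      split_ifs <;> omega
    · have := (mem_S.mp (hA ha)).1 i
      have := hc2 i
      simp only [σ]
      split_ifs <;> omega
  have hdisj : Disjoint (A.image σ) B := by
    rw [Finset.disjoint_left]
    intro b hb hbB
    obtain ⟨a, ha, rfl⟩ := Finset.mem_image.mp hb
    obtain ⟨i, hi, _, h1, -⟩ := hAB a ha _ hbB
    have := hc2 ⟨i, hi⟩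
    simp only [σ] at h1
    split_ifs at h1 <;> omega
  have hle : A.card + B.card ≤ (S c n).card := by
    rw [← Finset.card_image_of_injOn hinj, ← Finset.card_union_of_disjoint hdisj]
    exact Finset.card_le_card (Finset.union_subset (fun b hb => by
      obtain ⟨a, ha, rfl⟩ := Finset.mem_image.mp hb
      exact hσ a ha) hB)
  have hS : (S c n).card ≤ (star c n 0 1).card + (star c n 0 2).card := by
    refine (Finset.card_le_card fun a ha => ?_).trans (Finset.card_union_le _ _)
    rw [Finset.mem_union, mem_star, mem_star]
    have h1 := ne_zero_of_mem_S ha 0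
    have h2 := (mem_S.mp ha).1 0
    have : a 0 = 1 ∨ a 0 = 2 := by omega
    exact this.imp (fun h => ⟨ha, h⟩) fun h => ⟨ha, h⟩
  have h21 : (star c n 0 2).card ≤ (star c n 0 1).card :=
    card_star_le le_rfl (by omega) le_rfl (by omega)
  generalize (star c n 0 1).card = x at *
  have : A.card + B.card ≤ 2 * x := by omega
  zify at this ⊢
  nlinarith [sq_nonneg ((A.card : ℤ) - B.card)]

end FullSupport

/-! ### From pairs to `k` families. -/

theorem eq_of_prod_eq_prod {ι : Type*} [Fintype ι] {x y : ι → ℕ} (hy : ∀ i, 0 < y i)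
    (hle : ∀ i, x i ≤ y i) (h : ∏ i, x i = ∏ i, y i) (i : ι) : x i = y i := by
  have hpos : ∀ l, 0 < x l := by
    have : 0 < ∏ l, x l := h ▸ Finset.prod_pos fun l _ => hy l
    exact fun l =>
      Nat.pos_of_ne_zero (Finset.prod_ne_zero_iff.mp this.ne' l (Finset.mem_univ l))
  by_contra hne
  exact (Finset.prod_lt_prod (fun l _ => hpos l) (fun l _ => hle l)
    ⟨i, Finset.mem_univ i, lt_of_le_of_ne (hle i) hne⟩).ne h

theorem prod_le_prod_of_mul_le_mul {k : ℕ} (hk : 2 ≤ k) {x y : Fin k → ℕ} (hy : ∀ i, 0 < y i)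
    (h : ∀ i j, i ≠ j → x i * x j ≤ y i * y j) :
    ∏ i, x i ≤ ∏ i, y i ∧
      (∏ i, x i = ∏ i, y i → ∀ i j, i ≠ j → x i * x j = y i * y j) := by
  have : NeZero k := ⟨by omega⟩
  -- Addition in `Fin k` is cyclic. The shift `d = 1` gives the bound, and `d = j - i` isolates the
  -- pair `i, j` in the case of equality.
  have hsq : ∀ (z : Fin k → ℕ) (d : Fin k), ∏ i, z i * z (i + d) = (∏ i, z i) * ∏ i, z i := by
    intro z d
    rw [Finset.prod_mul_distrib]
    congr 1
    exact Equiv.prod_comp (Equiv.addRight d) z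
  have hne : ∀ d : Fin k, d ≠ 0 → ∀ i, i ≠ i + d := by
    intro d hd i hi
    exact hd (left_eq_add.mp hi)
  constructor
  · have h10 : (⟨1, by omega⟩ : Fin k) ≠ 0 := by
      intro h
      simpa using congrArg Fin.val h
    refine Nat.mul_self_le_mul_self_iff.mp ?_
    rw [← hsq x ⟨1, by omega⟩, ← hsq y ⟨1, by omega⟩]
    exact Finset.prod_le_prod' fun i _ => h _ _ (hne _ h10 i)
  · intro heq i j hij
    have hd : j - i ≠ 0 := sub_ne_zero.mpr hij.symm
    have heq2 : ∏ l, x l * x (l + (j - i)) = ∏ l, y l * y (l + (j - i)) := by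
      rw [hsq, hsq, heq]
    have := eq_of_prod_eq_prod (fun l => Nat.mul_pos (hy l) (hy _))
      (fun l => h _ _ (hne _ hd l)) heq2 i
    rwa [add_sub_cancel] at this

theorem SameSeq.zero_eq {n m : ℕ} [NeZero n] [NeZero m] {c : Fin n → ℕ} {d : Fin m → ℕ}
    (h : SameSeq c d) : c 0 = d 0 :=
  h.2 0 (NeZero.pos n) (NeZero.pos m)

theorem SameSeq.card_mul_card_le {n m : ℕ} [NeZero n] [NeZero m] {c : Fin n → ℕ}
    {d : Fin m → ℕ} (h : SameSeq c d) (hc : IsIP c) (h2 : c 0 = 2) {A : Finset (Fin n → ℕ)}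
    {B : Finset (Fin m → ℕ)} (hA : A ⊆ S c n) (hB : B ⊆ S d m)
    (hAB : ∀ a ∈ A, ∀ b ∈ B, Meets a b) :
    A.card * B.card ≤ (star c n 0 1).card * (star d m 0 1).card := by
  obtain ⟨rfl, h⟩ := h
  obtain rfl : c = d := funext fun i => h i i.2 i.2
  exact card_mul_card_le_of_zero_eq_two hc h2 hA hB hAB

theorem eq_zero_or_one_of_card_star_le {n : ℕ} [NeZero n] {c : Fin n → ℕ} (hc : IsIP c) {r : ℕ}
    (hr : 1 ≤ r ∧ r ≤ n) {p : Fin n} {q : ℕ} (hq : 1 ≤ q)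
    (h : (star c r 0 1).card ≤ (star c r p q).card) : c p = c 0 ∨ r = 1 := by
  by_contra! hne
  have hlt : c 0 < c p := lt_of_le_of_ne (hc.1 (Fin.zero_le p)) hne.1.symm
  exact absurd h (not_le.mpr (card_star_lt hc (by omega) hr.2 hlt hq le_rfl (hc.2 0)))

theorem le_of_star_nonempty {n : ℕ} {c : Fin n → ℕ} {r : ℕ} {p : Fin n} {q : ℕ}
    (h : (star c r p q).Nonempty) : q ≤ c p := by
  obtain ⟨a, ha⟩ := h
  rw [mem_star, mem_S] at ha
  exact ha.2 ▸ ha.1.1 p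

/-- The theorem for families with all bounds at least `3`. -/
theorem prod_card_le_of_three_le {k : ℕ} (hk : 2 ≤ k) {n : Fin k → ℕ} [∀ i, NeZero (n i)]
    {c : (i : Fin k) → Fin (n i) → ℕ} (hc : ∀ i, IsIP (c i)) {r : Fin k → ℕ}
    (hr : ∀ i, 1 ≤ r i ∧ r i ≤ n i) (h3 : ∀ i, 3 ≤ c i 0)
    {A : (i : Fin k) → Finset (Fin (n i) → ℕ)} (hA : ∀ i, A i ⊆ S (c i) (r i))
    (hcross : ∀ i j, i ≠ j → ∀ a ∈ A i, ∀ b ∈ A j, Meets a b) :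
    ∏ i, (A i).card ≤ ∏ i, (star (c i) (r i) 0 1).card ∧
      (∏ i, (A i).card = ∏ i, (star (c i) (r i) 0 1).card →
        ∃ (p : ℕ) (hp : ∀ i, p < n i) (q : ℕ),
          (∀ i, c i ⟨p, hp i⟩ = c i 0 ∨ r i = 1) ∧
          1 ≤ q ∧ (∀ i, q ≤ c i ⟨p, hp i⟩) ∧
          ∀ i, A i = star (c i) (r i) ⟨p, hp i⟩ q) := by
  have hpos : ∀ i, 0 < (star (c i) (r i) 0 1).card := fun i =>
    card_star_zero_pos (hc i) (hr i).1 (hr i).2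
  have hpair := fun i j (hij : i ≠ j) => card_mul_card_le (hc i) (hc j) (h3 i) (h3 j) (hr i) (hr j)
    (hA i) (hA j) (hcross i j hij)
  obtain ⟨h1, h2⟩ := prod_le_prod_of_mul_le_mul hk hpos fun i j hij => (hpair i j hij).1
  refine ⟨h1, fun heq => ?_⟩
  have heq' := h2 heq
  have hApos : ∀ i, (A i).Nonempty := by
    have : 0 < ∏ i, (A i).card := heq ▸ Finset.prod_pos fun i _ => hpos i
    intro i
    rw [← Finset.card_ne_zero]
    exact Finset.prod_ne_zero_iff.mp this.ne' i (Finset.mem_univ i)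
  have h01 : (⟨0, by omega⟩ : Fin k) ≠ ⟨1, by omega⟩ := by simp
  generalize (⟨0, by omega⟩ : Fin k) = u at h01
  generalize (⟨1, by omega⟩ : Fin k) = v at h01
  obtain ⟨p, hpu, -, q, hq, hu, -⟩ := (hpair u v h01).2 (heq' u v h01)
  -- The family with index `u` is compared with every other one; since its star determines `p` and
  -- `q`, they are the same for all families.
  have hall : ∀ i, ∃ hp : p < n i, A i = star (c i) (r i) ⟨p, hp⟩ q := by
    intro i
    by_cases hi : u = i
    · subst hi
      exact ⟨hpu, hu⟩
    · obtain ⟨p', hpu', hpi, q', hq', hu', hi'⟩ := (hpair u i hi).2 (heq' u i hi)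
      obtain ⟨hpp, rfl⟩ := star_injective
        (fun j => (h3 u).trans ((hc u).1 (Fin.zero_le j))) hq' (hu ▸ hApos u) (hu ▸ hu')
      obtain rfl : p = p' := congrArg Fin.val hpp
      exact ⟨hpi, hi'⟩
  choose hp hstar using hall
  have hqc : ∀ i, q ≤ c i ⟨p, hp i⟩ := fun i => le_of_star_nonempty (hstar i ▸ hApos i)
  refine ⟨p, hp, q, fun i => ?_, hq, hqc, hstar⟩
  refine eq_zero_or_one_of_card_star_le (hc i) (hr i) hq ?_
  rw [← hstar i]
  have hle : ∀ i, (A i).card ≤ (star (c i) (r i) 0 1).card := by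
    intro i
    rw [hstar i]
    exact card_star_le ((hc i).1 (Fin.zero_le _)) hq le_rfl ((hc i).2 0)
  exact (eq_of_prod_eq_prod hpos hle heq i).ge

end IntSeq

theorem theorem3 (k : ℕ) (hk : 2 ≤ k) (n : Fin k → ℕ) [∀ i, NeZero (n i)]
    (c : (i : Fin k) → Fin (n i) → ℕ) (hc : ∀ i, IntSeq.IsIP (c i))
    (r : Fin k → ℕ) (hr : ∀ i, 1 ≤ r i ∧ r i ≤ n i)
    (hcr : (∀ i, 3 ≤ c i 0) ∨
      ((∀ i j, IntSeq.SameSeq (c i) (c j)) ∧ ∀ i, r i = n ⟨0, by omega⟩))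
    (A : (i : Fin k) → Finset (Fin (n i) → ℕ)) (hA : ∀ i, A i ⊆ IntSeq.S (c i) (r i))
    (hcross : ∀ i j, i ≠ j → ∀ a ∈ A i, ∀ b ∈ A j, IntSeq.Meets a b) :
    (∏ i, (A i).card ≤ ∏ i, IntSeq.bound (c i) (r i)) ∧
    ((∀ i, A i = IntSeq.star (c i) (r i) 0 1) →
      ∏ i, (A i).card = ∏ i, IntSeq.bound (c i) (r i)) ∧
    (c ⟨0, by omega⟩ 0 ≠ 2 →
      (∏ i, (A i).card = ∏ i, IntSeq.bound (c i) (r i) ↔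
        ∃ (p : ℕ) (hp : ∀ i, p < n i) (q : ℕ),
          (∀ i, c i ⟨p, hp i⟩ = c i 0 ∨ r i = 1) ∧
          1 ≤ q ∧ (∀ i, q ≤ c i ⟨p, hp i⟩) ∧
          ∀ i, A i = IntSeq.star (c i) (r i) ⟨p, hp i⟩ q)) := by
  have hbound : ∀ i, IntSeq.bound (c i) (r i) = (IntSeq.star (c i) (r i) 0 1).card := fun i =>
    (IntSeq.card_star_zero_eq_bound (hc i) (hr i).1).symm
  simp only [hbound]
  suffices h : ∏ i, (A i).card ≤ ∏ i, (IntSeq.star (c i) (r i) 0 1).card ∧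
      (c ⟨0, by omega⟩ 0 ≠ 2 → ∏ i, (A i).card = ∏ i, (IntSeq.star (c i) (r i) 0 1).card →
        ∃ (p : ℕ) (hp : ∀ i, p < n i) (q : ℕ),
          (∀ i, c i ⟨p, hp i⟩ = c i 0 ∨ r i = 1) ∧
          1 ≤ q ∧ (∀ i, q ≤ c i ⟨p, hp i⟩) ∧
          ∀ i, A i = IntSeq.star (c i) (r i) ⟨p, hp i⟩ q) by
    refine ⟨h.1, fun hstar => Finset.prod_congr rfl fun i _ => by rw [hstar i], fun hne =>
      ⟨h.2 hne, ?_⟩⟩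
    rintro ⟨p, hp, q, hpc, hq, hqc, hstar⟩
    refine Finset.prod_congr rfl fun i _ => ?_
    rw [hstar i]
    exact IntSeq.card_star_eq (hc i) (hpc i) hq (hqc i)
  by_cases h3 : ∀ i, 3 ≤ c i 0
  · have := IntSeq.prod_card_le_of_three_le hk hc hr h3 hA hcross
    exact ⟨this.1, fun _ => this.2⟩
  obtain ⟨hsame, hrn⟩ := hcr.resolve_left h3
  have hrn' : ∀ i, r i = n i := fun i => (hrn i).trans (hsame _ i).1
  obtain rfl : r = n := funext hrn'
  have hc0 : ∀ i, c i 0 = c ⟨0, by omega⟩ 0 := fun i => (hsame i _).zero_eq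
  push Not at h3
  obtain ⟨j, hj⟩ := h3
  have hj0 := hc0 j
  have hj1 := (hc j).2 0
  by_cases h2 : c ⟨0, by omega⟩ 0 = 2
  · refine ⟨?_, fun hne => absurd h2 hne⟩
    exact (IntSeq.prod_le_prod_of_mul_le_mul hk
      (fun i => IntSeq.card_star_zero_pos (hc i) (hr i).1 le_rfl) fun i l hil =>
        (hsame i l).card_mul_card_le (hc i) ((hc0 i).trans h2) (hA i) (hA l)
          (hcross i l hil)).1
  -- The common first bound is below 3 and not 2. With first bound 1 and no zeros, every sequence
  -- lies in the star of 1s in the first position, so equality means that each family is the whole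
  -- star.
  · have h1 : ∀ i, c i 0 = 1 := fun i => by
      have := hc0 i
      omega
    have hsub : ∀ i, A i ⊆ IntSeq.star (c i) (r i) 0 1 := fun i => by
      rw [← IntSeq.S_eq_star_of_zero_eq_one (h1 i)]
      exact hA i
    have hle : ∀ i, (A i).card ≤ (IntSeq.star (c i) (r i) 0 1).card := fun i =>
      Finset.card_le_card (hsub i)
    refine ⟨Finset.prod_le_prod' fun i _ => hle i, fun _ heq => ?_⟩
    have heq' := IntSeq.eq_of_prod_eq_prod
      (fun i => IntSeq.card_star_zero_pos (hc i) (hr i).1 le_rfl) hle heq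
    exact ⟨0, fun i => NeZero.pos _, 1, fun i => Or.inl rfl, le_rfl, fun i => (h1 i).ge, fun i =>
      Finset.eq_of_subset_of_card_le (hsub i) (heq' i).ge⟩
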